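/- Let $\mathsf B$ be a locally presentable abelian category with enough projective objects, let $\mathsf C(\mathsf B)$ be the abelian category of unbounded complexes in $\mathsf B$, and let $\mathsf K(\mathsf B)$ be the homotopy category of complexes. Let $\mathsf C(\mathsf B_{\mathrm{proj}})\subset\mathsf C(\mathsf B)$ be the class of all complexes of projective objects, and let $\mathsf C(\mathsf B)^{\mathrm{ctr}}_{\mathrm{ac}}\subset\mathsf C(\mathsf B)$ be the class of all contraacyclic complexes in the sense of Becker, i.e. of all complexes $X$ such that $\operatorname{Hom}_{\mathsf K(\mathsf B)}(P,X)=0$ for every $P\in\mathsf C(\mathsf B_{\mathrm{proj}})$. (1) The pair $(\mathsf C(\mathsf B_{\mathrm{proj}}),\,\mathsf C(\mathsf B)^{\mathrm{ctr}}_{\mathrm{ac}})$ is a hereditary complete cotorsion pair in $\mathsf C(\mathsf B)$. That is, writing $(\mathsf L,\mathsf W)$ for the pair: $\mathsf W$ is the class of all $X$ with $\operatorname{Ext}^1(L,X)=0$ for all $L\in\mathsf L$; $\mathsf L$ is the class of all $Y$ with $\operatorname{Ext}^1(Y,W)=0$ for all $W\in\mathsf W$; every object $E$ of $\mathsf C(\mathsf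 B)$ admits short exact sequences $0\to W'\to L\to E\to0$ and $0\to E\to W\to L'\to0$ with $L,L'\in\mathsf L$ and $W,W'\in\mathsf W$; $\mathsf L$ contains the kernels of epimorphisms between its objects; $\mathsf W$ contains the cokernels of monomorphisms between its objects; and $\operatorname{Ext}^n(L,W)=0$ for all $L\in\mathsf L$, $W\in\mathsf W$, $n\ge1$ (all $\operatorname{Ext}$ groups are taken in the abelian category $\mathsf C(\mathsf B)$). (2) There is a set $\mathsf S\subset\mathsf C(\mathsf B_{\mathrm{proj}})$ of complexes of projective objects such that $\mathsf C(\mathsf B_{\mathrm{proj}})$ is the class of all direct summands of complexes filtered by $\mathsf S$, and the cotorsion pair in (1) is generated by $\mathsf S$, i.e. $\mathsf W$ is the class of all $X$ with $\operatorname{Ext}^1(S,X)=0$ for all $S\in\mathsf S$. Here an object $F$ is filtered by $\mathsf S$ if there are an ordinal $\alpha$ and an inductive system $(F_i)_{0\le i\le\alpha}$ with $F_0=0$, $F_\alpha=F$, $F_j=\varinjlim_{i<j}F_i$ for all limit ordinals $j\le\alpha$, in which every $F_i\to F_{i+1}$, $i<\alpha$, is a monomorphism with cokernel isomorphic to an object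 of $\mathsf S$. (3) There is a cofibrantly generated hereditary abelian model structure on $\mathsf C(\mathsf B)$ (the contraderived model structure) whose class of cofibrant objects is $\mathsf C(\mathsf B_{\mathrm{proj}})$, whose class of weakly trivial objects (those $X$ for which $0\to X$ is a weak equivalence) is $\mathsf C(\mathsf B)^{\mathrm{ctr}}_{\mathrm{ac}}$, and in which all objects are fibrant. Here a model structure is abelian if the cofibrations are the monomorphisms with cofibrant cokernel and the fibrations are the epimorphisms with fibrant kernel. It is cofibrantly generated if there are sets of morphisms $I$ and $J$ such that the trivial fibrations are the morphisms having the right lifting property with respect to $I$ and the fibrations are the morphisms having the right lifting property with respect to $J$. It is hereditary if the classes of cofibrant and of trivially cofibrant (cofibrant and weakly trivial) objects contain the kernels of epimorphisms between their objects, and the classes of fibrant and of trivially fibrant (fibrant and weakly trivial) objects contain the cokernels of monomorphisms between their objects. -/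

import Mathlib

universe v u

open CategoryTheory Limits HomotopicalAlgebra

namespace Contraderived

section Cotorsion

variable {E : Type u} [Category.{v} E] [Abelian E]

/-- `Ext^n(X, Y) = 0` in the abelian category `E`. -/
def ExtVanishes (n : ℕ) (X Y : E) : Prop :=
  letI : HasExt.{max u v} E := HasExt.standard E
  Subsingleton (Abelian.Ext.{max u v} X Y n)

/-- The class of all `X` such that `Ext^1(A, X) = 0` for all `A` in `L`. -/
def rightExtOrthogonal (L : ObjectProperty E) : ObjectProperty E :=
  fun X => ∀ A : E, L A → ExtVanishes 1 A X

/-- The class of all `Y` such that `Ext^1(Y, A) = 0` for all `A` in `R`. -/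
def leftExtOrthogonal (R : ObjectProperty E) : ObjectProperty E :=
  fun Y => ∀ A : E, R A → ExtVanishes 1 Y A

/-- Cotorsion pairs of classes of objects. -/
structure IsCotorsionPair (L R : ObjectProperty E) : Prop where
  right_eq : R = rightExtOrthogonal L
  left_eq : L = leftExtOrthogonal R

/-- A cotorsion pair is complete if every object `X` admits a special precover sequence
`0 ⟶ K ⟶ Q ⟶ X ⟶ 0` and a special preenvelope sequence `0 ⟶ X ⟶ K ⟶ Q ⟶ 0`,
where `Q` is in `L` and `K` is in `R`. -/
structure IsCompleteCotorsionPair (L R : ObjectProperty E) : Prop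
    extends IsCotorsionPair L R where
  exists_precover (X : E) : ∃ (K Q : E) (i : K ⟶ Q) (p : Q ⟶ X) (w : i ≫ p = 0),
    (ShortComplex.mk i p w).ShortExact ∧ R K ∧ L Q
  exists_preenvelope (X : E) : ∃ (K Q : E) (i : X ⟶ K) (p : K ⟶ Q) (w : i ≫ p = 0),
    (ShortComplex.mk i p w).ShortExact ∧ R K ∧ L Q

/-- The class `P` contains the kernels of epimorphisms between its objects. -/
def ContainsKernelsOfEpis (P : ObjectProperty E) : Prop :=
  ∀ S : ShortComplex E, S.ShortExact → P S.X₂ → P S.X₃ → P S.X₁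

/-- The class `P` contains the cokernels of monomorphisms between its objects. -/
def ContainsCokernelsOfMonos (P : ObjectProperty E) : Prop :=
  ∀ S : ShortComplex E, S.ShortExact → P S.X₁ → P S.X₂ → P S.X₃

/-- Hereditary cotorsion pairs. For a complete cotorsion pair the three conditions are
equivalent to each other; all of them are recorded. -/
structure IsHereditaryCotorsionPair (L R : ObjectProperty E) : Prop where
  left_closed : ContainsKernelsOfEpis L
  right_closed : ContainsCokernelsOfMonos R
  ext_vanishes : ∀ n : ℕ, 1 ≤ n → ∀ A X : E, L A → R X → ExtVanishes n A X

/-- The pair of classes `(L, R)` is the cotorsion pair generated by the class `S`. -/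
structure IsGeneratedBy (S L R : ObjectProperty E) : Prop where
  right_eq : R = rightExtOrthogonal S
  left_eq : L = leftExtOrthogonal R

/-- The monomorphisms whose cokernel belongs to the class `P` (up to isomorphism). -/
def monosWithCokernelIn (P : ObjectProperty E) : MorphismProperty E :=
  fun _ _ f => Mono f ∧ P.isoClosure (cokernel f)

/-- The epimorphisms whose kernel belongs to the class `P` (up to isomorphism). -/
def episWithKernelIn (P : ObjectProperty E) : MorphismProperty E :=
  fun _ _ f => Epi f ∧ P.isoClosure (kernel f)

/-- The objects filtered by `S` (transfinitely iterated extensions, in the sense of the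
directed colimit, of objects of `S`): the morphism `0 ⟶ X` is the transfinite composition of
a smooth chain starting at `0` whose successive morphisms are monomorphisms with cokernels
in `S`. The well-ordered indexing sets are taken in the universe of the Hom-sets. -/
def filteredBy (S : ObjectProperty E) : ObjectProperty E :=
  fun X => MorphismProperty.transfiniteCompositions.{v} (monosWithCokernelIn S) (initial.to X)

end Cotorsion

section ModelStructure

/-- A class of morphisms `R`, thought of as the right class of a weak factorization
system, is cofibrantly generated: it is the class of all morphisms having the right lifting
property with respect to some set of morphisms. -/
def IsCofibrantlyGenerated {E : Type u} [Category.{v} E] (R : MorphismProperty E) : Prop :=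
  ∃ I : MorphismProperty E, MorphismProperty.IsSmall.{v} I ∧ I.rlp = R

/-- A model structure is cofibrantly generated if both the weak factorization systems
(cofibrations, trivial fibrations) and (trivial cofibrations, fibrations) are. -/
structure IsCofibrantlyGeneratedModel (E : Type u) [Category.{v} E] [ModelCategory E] :
    Prop where
  trivialFibrations : IsCofibrantlyGenerated (trivialFibrations E)
  fibrations : IsCofibrantlyGenerated (fibrations E)

variable (E : Type u) [Category.{v} E] [Abelian E] [ModelCategory E]

/-- The weakly trivial objects of a model structure on an abelian category: the objects `X`
such that `0 ⟶ X` is a weak equivalence. -/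
def weaklyTrivialObjects : ObjectProperty E :=
  fun X => WeakEquivalence (initial.to X)

/-- A model structure on an abelian category is abelian if the cofibrations are the
monomorphisms with cofibrant cokernel and the fibrations are the epimorphisms with fibrant
kernel. -/
structure IsAbelianModel : Prop where
  cofibrations_eq : cofibrations E = monosWithCokernelIn (cofibrantObjects E)
  fibrations_eq : fibrations E = episWithKernelIn (fibrantObjects E)

/-- Hereditary (abelian) model structures. For an abelian model structure the four conditions
are equivalent to each other; all of them are recorded. -/
structure IsHereditaryModel : Prop where
  cofibrant : ContainsKernelsOfEpis (cofibrantObjects E)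
  trivially_cofibrant : ContainsKernelsOfEpis (cofibrantObjects E ⊓ weaklyTrivialObjects E)
  fibrant : ContainsCokernelsOfMonos (fibrantObjects E)
  trivially_fibrant : ContainsCokernelsOfMonos (fibrantObjects E ⊓ weaklyTrivialObjects E)

end ModelStructure

section Complexes

variable (B : Type u) [Category.{v} B] [Abelian B]

/-- The class of (unbounded) complexes with projective terms. -/
def complexesOfProjectives : ObjectProperty (CochainComplex B ℤ) :=
  fun P => ∀ n : ℤ, Projective (P.X n)

/-- The contraacyclic complexes in the sense of Becker: the complexes `X` such that
`Hom(P, X) = 0` in the homotopy category for every complex `P` of projective objects. -/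
def contraacyclicComplexes : ObjectProperty (CochainComplex B ℤ) :=
  fun X => ∀ P : CochainComplex B ℤ, complexesOfProjectives B P →
    ∀ f : (HomotopyCategory.quotient B (ComplexShape.up ℤ)).obj P ⟶
      (HomotopyCategory.quotient B (ComplexShape.up ℤ)).obj X, f = 0

end Complexes

end Contraderived

open Contraderived

namespace Contraderived

open scoped ZeroObject

/-! ### Vanishing of `Ext` and lifting properties in an abelian category. -/

section Abelian

variable {E : Type u} [Category.{v} E] [Abelian E]

/-! Write L for the complexes of projectives and W for the contraacyclic ones. The cone of the
identity of P in L is projective in the category of complexes, and `P ⟶ coneId P ⟶ P⟦1⟧` is short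
exact. So Ext¹(P⟦1⟧, X) vanishes iff every `P ⟶ X` extends to the cone, i.e. is null-homotopic;
since L is closed under shifts, W = L^⊥ (`contraacyclicComplexes_eq`). For L = ^⊥W, the condition
Ext¹ = 0 is turned into lifting of monomorphisms against epimorphisms. Forgetting differentials has
`coneId` as right adjoint (on graded objects) and a shifted `coneId` as left adjoint. The cone of a
degreewise epimorphism has kernel in W, and lifting against such cones amounts to degreewise lifting
against epimorphisms, which forces projective cokernels
(`llp_episWithKernelIn_contraacyclicComplexes`). The set-theoretic core is
`complexesOfProjectives_le_retractClosure`. With a projective separator P, every complex in L is a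
retract of one whose terms are all the same copower of P. For κ regular and uncountable with P
κ-presentable, each index lies in a set of fewer than κ indices stable under all differentials;
well-ordering the indices then filters the complex by complexes of copowers of size less than κ.
These form a small class S, and Eklof's lemma gives S^⊥ = W. The small object argument then factors
every morphism as a monomorphism with cokernel in L followed by an epimorphism with kernel in W,
which gives completeness and half of the model structure. The other half is elementary: fibrations
are all epimorphisms, and X ↦ X ⊞ (projective over Y) factors. Weak equivalences are the maps
inducing bijections on Hom_K(P, -) for P in L, so two-out-of-three is immediate; it remains to
identify the trivial (co)fibrations. -/

lemma ExtVanishes.of_retract {n : ℕ} {A A' N : E} (h : ExtVanishes n A' N) (r : Retract A A') :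
    ExtVanishes n A N := by
  let _ : HasExt.{max u v} E := HasExt.standard E
  have h' : Subsingleton (Abelian.Ext.{max u v} A' N n) := h
  refine ⟨fun x y => ?_⟩
  have key (x : Abelian.Ext.{max u v} A N n) :
      (Abelian.Ext.mk₀ r.i).comp ((Abelian.Ext.mk₀ r.r).comp x (zero_add n)) (zero_add n) = x := by
    rw [Abelian.Ext.mk₀_comp_mk₀_assoc, r.retract, Abelian.Ext.mk₀_id_comp]
  rw [← key x, ← key y, Subsingleton.elim ((Abelian.Ext.mk₀ r.r).comp x (zero_add n))]

lemma ExtVanishes.of_retract_right {n : ℕ} {A N N' : E} (h : ExtVanishes n A N')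
    (r : Retract N N') : ExtVanishes n A N := by
  let _ : HasExt.{max u v} E := HasExt.standard E
  have h' : Subsingleton (Abelian.Ext.{max u v} A N' n) := h
  refine ⟨fun x y => ?_⟩
  have key (x : Abelian.Ext.{max u v} A N n) :
      (x.comp (Abelian.Ext.mk₀ r.i) (add_zero n)).comp (Abelian.Ext.mk₀ r.r) (add_zero n) = x := by
    rw [Abelian.Ext.comp_assoc_of_third_deg_zero, Abelian.Ext.mk₀_comp_mk₀, r.retract,
      Abelian.Ext.comp_mk₀_id]
  rw [← key x, ← key y, Subsingleton.elim (x.comp (Abelian.Ext.mk₀ r.i) (add_zero n))]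

lemma ExtVanishes.exists_extension {S : ShortComplex E} (hS : S.ShortExact) {N : E}
    (h : ExtVanishes 1 S.X₃ N) (g : S.X₁ ⟶ N) : ∃ h : S.X₂ ⟶ N, S.f ≫ h = g := by
  let _ : HasExt.{max u v} E := HasExt.standard E
  have h' : Subsingleton (Abelian.Ext.{max u v} S.X₃ N 1) := h
  obtain ⟨x, hx⟩ := Abelian.Ext.contravariant_sequence_exact₁ hS N (Abelian.Ext.mk₀ g)
    (add_zero 1) (Subsingleton.elim _ _)
  obtain ⟨φ, rfl⟩ := Abelian.Ext.mk₀_bijective _ _ |>.2 x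
  exact ⟨φ, (Abelian.Ext.mk₀_bijective _ _).1 (by rw [← hx, Abelian.Ext.mk₀_comp_mk₀])⟩

lemma extVanishes_one_of_exists_extension {S : ShortComplex E} (hS : S.ShortExact)
    [Projective S.X₂] {N : E} (h : ∀ g : S.X₁ ⟶ N, ∃ h : S.X₂ ⟶ N, S.f ≫ h = g) :
    ExtVanishes 1 S.X₃ N := by
  let _ : HasExt.{max u v} E := HasExt.standard E
  suffices ∀ x : Abelian.Ext.{max u v} S.X₃ N 1, x = 0 from ⟨fun x y => by rw [this x, this y]⟩
  intro x
  obtain ⟨y, rfl⟩ := Abelian.Ext.contravariant_sequence_exact₃ hS N x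
    (@Subsingleton.elim _ (Abelian.Ext.subsingleton_of_projective _ _ 0) _ _) (add_zero 1)
  obtain ⟨g, rfl⟩ := Abelian.Ext.mk₀_bijective _ _ |>.2 y
  obtain ⟨g, rfl⟩ := h g
  rw [← Abelian.Ext.mk₀_comp_mk₀,
    ← Abelian.Ext.comp_assoc _ _ _ (add_zero 1) (zero_add 0) (by lia), hS.extClass_comp,
    Abelian.Ext.zero_comp]

lemma ExtVanishes.succ {S : ShortComplex E} (hS : S.ShortExact) [Projective S.X₂] {N : E}
    {n : ℕ} (h : ExtVanishes n S.X₁ N) : ExtVanishes (n + 1) S.X₃ N := by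
  let _ : HasExt.{max u v} E := HasExt.standard E
  have h' : Subsingleton (Abelian.Ext.{max u v} S.X₁ N n) := h
  suffices ∀ x : Abelian.Ext.{max u v} S.X₃ N (n + 1), x = 0 from
    ⟨fun x y => by rw [this x, this y]⟩
  intro x
  obtain ⟨y, rfl⟩ := Abelian.Ext.contravariant_sequence_exact₃ hS N x
    (@Subsingleton.elim _ (Abelian.Ext.subsingleton_of_projective _ _ n) _ _) (add_comm 1 n)
  rw [Subsingleton.elim y 0, Abelian.Ext.comp_zero]

lemma shortExact_cokernel {A A' : E} (i : A ⟶ A') [Mono i] :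
    (ShortComplex.mk i (cokernel.π i) (cokernel.condition i)).ShortExact where
  exact := ShortComplex.exact_cokernel i

lemma shortExact_kernel {X Y : E} (p : X ⟶ Y) [Epi p] :
    (ShortComplex.mk (kernel.ι p) p (kernel.condition p)).ShortExact where
  exact := ShortComplex.exact_kernel p

/-- Cover `cokernel i` by a projective object and lift that cover to `A'`; then `A'` is a quotient
of `A ⊞ Projective.over (cokernel i)`. The lift is built on both summands and glued. -/
lemma hasLiftingProperty_of_extVanishes [EnoughProjectives E] {A A' X Y : E}
    (i : A ⟶ A') (p : X ⟶ Y) [Mono i] [Epi p] (h : ExtVanishes 1 (cokernel i) (kernel p)) :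
    HasLiftingProperty i p where
  sq_hasLift {u w} sq := by
    let π := Projective.π (cokernel i)
    let k := kernel.ι π
    let e : Projective.over (cokernel i) ⟶ A' := Projective.factorThru π (cokernel.π i)
    have he : e ≫ cokernel.π i = π := Projective.factorThru_comp _ _
    obtain ⟨a, ha⟩ := KernelFork.IsLimit.lift' (Abelian.monoIsKernelOfCokernel _
      (cokernelIsCokernel i)) (k ≫ e) (by
        change (k ≫ e) ≫ cokernel.π i = 0
        rw [Category.assoc, he, kernel.condition])
    change a ≫ i = k ≫ e at ha
    let t : Projective.over (cokernel i) ⟶ X := Projective.factorThru (e ≫ w) p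
    have ht : t ≫ p = e ≫ w := Projective.factorThru_comp _ _
    -- On the kernel of the cover, `t` and `u` disagree by a map into `kernel p`. Vanishing of Ext¹
    -- extends this discrepancy to the whole cover, so `t` can be corrected by it.
    obtain ⟨c, hc⟩ := h.exists_extension (shortExact_kernel π)
      (kernel.lift p (a ≫ u - k ≫ t) (by
        rw [Preadditive.sub_comp, Category.assoc, Category.assoc, sq.w, ht, reassoc_of% ha,
          sub_self]))
    let t' := t + c ≫ kernel.ι p
    have ht' : t' ≫ p = e ≫ w := by simp [t', ht]
    have hk : k ≫ t' = a ≫ u := by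
      have := hc =≫ kernel.ι p
      simp only [kernel.lift_ι] at this
      change (k ≫ c) ≫ _ = _ at this
      simp only [t', Preadditive.comp_add, ← Category.assoc]
      rw [this]
      abel
    have : Epi (biprod.desc i e) := by
      rw [Preadditive.epi_iff_cancel_zero]
      intro Z φ hφ
      have h₁ : i ≫ φ = 0 := by simpa using biprod.inl ≫= hφ
      have h₂ : e ≫ φ = 0 := by simpa using biprod.inr ≫= hφ
      obtain ⟨ψ, rfl⟩ : ∃ ψ, φ = cokernel.π i ≫ ψ := ⟨cokernel.desc i φ h₁, by simp⟩
      rw [← Category.assoc, he] at h₂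
      rw [zero_of_epi_comp π h₂, comp_zero]
    have hdesc {T Z : E} (φ : T ⟶ A ⊞ Projective.over (cokernel i)) (f : A ⟶ Z)
        (g : Projective.over (cokernel i) ⟶ Z) :
        φ ≫ biprod.desc f g = (φ ≫ biprod.fst) ≫ f + (φ ≫ biprod.snd) ≫ g := by
      simp [biprod.desc_eq]
    have hker : kernel.ι (biprod.desc i e) ≫ biprod.desc u t' = 0 := by
      set x := kernel.ι (biprod.desc i e) ≫ biprod.fst with hx
      set y := kernel.ι (biprod.desc i e) ≫ biprod.snd with hy
      have hxy : x ≫ i + y ≫ e = 0 := by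
        have := kernel.condition (biprod.desc i e)
        rwa [hdesc] at this
      have h₁ : y ≫ π = 0 := by
        simpa [he] using hxy =≫ cokernel.π i
      have h₂ : x ≫ i = - kernel.lift π y h₁ ≫ a ≫ i := by
        rw [ha, kernel.lift_ι_assoc]
        exact eq_neg_of_add_eq_zero_left hxy
      have h₃ : x = - kernel.lift π y h₁ ≫ a := by
        rw [← cancel_mono i, h₂]; simp
      rw [hdesc, ← hx, ← hy, h₃]
      have hy' : kernel.lift π y h₁ ≫ k = y := kernel.lift_ι _ _ _
      have hy'' : y ≫ t' = kernel.lift π y h₁ ≫ a ≫ u := by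
        rw [← hk, ← Category.assoc, hy']
      rw [hy'']
      simp
    let l := (Abelian.epiDesc (biprod.desc i e) (biprod.desc u t') hker)
    have hl : biprod.desc i e ≫ l = biprod.desc u t' := Abelian.comp_epiDesc _ _ _
    refine ⟨⟨⟨l, by simpa using biprod.inl ≫= hl, ?_⟩⟩⟩
    rw [← cancel_epi (biprod.desc i e), reassoc_of% hl]
    ext
    · simp [sq.w]
    · simp [ht']

/-- Pushing the projective presentation of `C` out along `g` gives an extension of `C` by `N`.
Lifting `𝟙 C` splits it, and the splitting yields the required extension of `g`. -/
lemma extVanishes_of_hasLiftingProperty [EnoughProjectives E] {C N : E}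
    (h : ∀ ⦃X Y : E⦄ (p : X ⟶ Y) [Epi p], Nonempty (kernel p ≅ N) →
      HasLiftingProperty (initial.to C) p) : ExtVanishes 1 C N := by
  let π := Projective.π C
  let k := kernel.ι π
  refine extVanishes_one_of_exists_extension (shortExact_kernel π) (N := N) (fun g => ?_)
  change kernel π ⟶ N at g
  let q : pushout k g ⟶ C := pushout.desc π 0 (by simp [k])
  have hq₁ : pushout.inl k g ≫ q = π := pushout.inl_desc _ _ _
  have hq₂ : pushout.inr k g ≫ q = 0 := pushout.inr_desc _ _ _
  have : Epi q := epi_of_epi_fac hq₁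
  let S := ShortComplex.mk (pushout.inr k g) q hq₂
  have hS : S.Exact := by
    apply ShortComplex.exact_of_g_is_cokernel
    refine CokernelCofork.IsColimit.ofπ' _ _ (fun {T} φ hφ => ?_)
    have h₁ : k ≫ pushout.inl k g ≫ φ = 0 := by
      rw [pushout.condition_assoc]
      exact (g ≫= hφ).trans comp_zero
    refine ⟨Abelian.epiDesc π _ h₁, ?_⟩
    apply pushout.hom_ext
    · rw [reassoc_of% hq₁]
      exact Abelian.comp_epiDesc _ _ _
    · rw [reassoc_of% hq₂, zero_comp]
      exact hφ.symm
  have hlp := h q ⟨kernelIsKernel q |>.conePointUniqueUpToIso hS.fIsKernel⟩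
  have sq : CommSq (initial.to _) (initial.to C) q (𝟙 C) := ⟨Subsingleton.elim _ _⟩
  obtain ⟨b, hb⟩ := KernelFork.IsLimit.lift' hS.fIsKernel
    (pushout.inl k g - π ≫ sq.lift) (by
      change _ ≫ q = 0
      rw [Preadditive.sub_comp, hq₁, Category.assoc, sq.fac_right, Category.comp_id, sub_self])
  change b ≫ pushout.inr k g = _ at hb
  refine ⟨b, ?_⟩
  rw [← cancel_mono (pushout.inr k g), Category.assoc, hb]
  change k ≫ _ = _
  rw [Preadditive.comp_sub, pushout.condition, kernel.condition_assoc, zero_comp, sub_zero]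

lemma epimorphisms_llp_iff {A A' : E} (i : A ⟶ A') :
    (MorphismProperty.epimorphisms E).llp i ↔ Mono i ∧ Projective (cokernel i) := by
  constructor
  · intro h
    have hi : Mono i := by
      -- The map to the terminal object is epi because its target is zero; lifting against it
      -- produces a retraction of `i`.
      have hz := HasZeroObject.zeroIsTerminal (C := E)
      have := h (terminal.from A) (show Epi _ from (isZero_zero E).of_iso
        (terminalIsTerminal.uniqueUpToIso hz) |>.epi _)
      have sq : CommSq (𝟙 A) i (terminal.from A) (terminal.from A') := ⟨Subsingleton.elim _ _⟩
      exact mono_of_mono_fac sq.fac_left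
    refine ⟨hi, ⟨fun {M N} f e _ => ?_⟩⟩
    have := h e (show Epi e from inferInstance)
    have sq : CommSq 0 i e (cokernel.π i ≫ f) := ⟨by simp⟩
    refine ⟨cokernel.desc i sq.lift sq.fac_left, ?_⟩
    rw [← cancel_epi (cokernel.π i), cokernel.π_desc_assoc, sq.fac_right]
  · rintro ⟨_, _⟩ X Y p (_ : Epi p)
    have : Projective (ShortComplex.mk i _ (cokernel.condition i)).X₃ := by assumption
    let s := (shortExact_cokernel i).splittingOfProjective
    refine ⟨fun {a b} sq => ⟨⟨⟨s.r ≫ a + cokernel.π i ≫ Projective.factorThru (s.s ≫ b) p,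
      ?_, ?_⟩⟩⟩⟩
    · have := s.f_r
      dsimp at this
      simp [reassoc_of% this]
    · have := s.id
      dsimp at this
      simp only [Preadditive.add_comp, Category.assoc, Projective.factorThru_comp, sq.w]
      rw [← Category.assoc, ← Category.assoc, ← Preadditive.add_comp, this, Category.id_comp]

lemma epimorphisms_llp_initial_to_iff (C : E) :
    (MorphismProperty.epimorphisms E).llp (initial.to C) ↔ Projective C := by
  constructor
  · intro h
    refine ⟨fun {M N} f e _ => ?_⟩
    have := h e (show Epi e from inferInstance)
    have sq : CommSq (initial.to _) (initial.to C) e f := ⟨Subsingleton.elim _ _⟩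
    exact ⟨sq.lift, sq.fac_right⟩
  · intro _ X Y p (_ : Epi p)
    exact ⟨fun {a b} sq => ⟨⟨⟨Projective.factorThru b p, Subsingleton.elim _ _, by simp⟩⟩⟩⟩

end Abelian

/-! ### Cones of identities, null-homotopies and projective complexes. -/

section Cone

open CochainComplex CochainComplex.HomComplex CochainComplex.mappingCone

variable {B : Type u} [Category.{v} B] [Abelian B]

/-- The cone of the identity of a complex. -/
noncomputable abbrev coneId (Z : CochainComplex B ℤ) : CochainComplex B ℤ := mappingCone (𝟙 Z)

/-- The morphism `Z ⟶ coneId Z`. -/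
noncomputable abbrev coneIdInr (Z : CochainComplex B ℤ) : Z ⟶ coneId Z := inr (𝟙 Z)

/-- With `coneId_hom_ext`, this is the adjunction with graded objects: a chain map out of the cone
is an arbitrary cochain of degree -1, since its component on `Z` is forced to be the coboundary. -/
lemma exists_coneId_desc {Z X : CochainComplex B ℤ} (α : Cochain Z X (-1)) :
    ∃ f : coneId Z ⟶ X, ∀ (p q : ℤ) (h : p + (-1) = q),
      (inl (𝟙 Z)).v p q h ≫ f.f q = α.v p q h := by
  let β : Z ⟶ X := (Cocycle.mk (δ (-1) 0 α) 1 (by simp) (by simp [δ_δ])).homOf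
  exact ⟨desc (𝟙 Z) α β (by simp [β, Cocycle.cochain_ofHom_homOf_eq_coe]), by simp⟩

lemma coneId_hom_ext {Z X : CochainComplex B ℤ} {f g : coneId Z ⟶ X}
    (h : ∀ (p q : ℤ) (h : p + (-1) = q),
      (inl (𝟙 Z)).v p q h ≫ f.f q = (inl (𝟙 Z)).v p q h ≫ g.f q) : f = g := by
  have h' : (inl (𝟙 Z)).comp (Cochain.ofHom f) (add_zero _) =
      (inl (𝟙 Z)).comp (Cochain.ofHom g) (add_zero _) := by
    ext p q hpq
    simpa using h p q hpq
  have h'' := congr_arg (δ (-1) 0) h'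
  simp only [δ_comp_ofHom, δ_inl, Category.id_comp, ← Cochain.ofHom_comp] at h''
  replace h'' := (Cochain.ofHom_injective) h''
  ext n
  rw [ext_from_iff _ (n + 1) n rfl]
  exact ⟨h _ _ _, HomologicalComplex.congr_hom h'' n⟩

/-- The dual adjunction: with `hom_coneId_ext`, chain maps into the cone are arbitrary degree 0
cochains. -/
lemma exists_coneId_lift {Z X : CochainComplex B ℤ} (β : Cochain X Z 0) :
    ∃ f : X ⟶ coneId Z, ∀ n : ℤ, f.f n ≫ (snd (𝟙 Z)).v n n (add_zero n) =
      β.v n n (add_zero n) := by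
  refine ⟨lift (𝟙 Z) (Cocycle.mk (- δ 0 1 β) 2 (by simp) (by simp [δ_δ])) β ?_, by simp⟩
  simp

lemma hom_coneId_ext {Z X : CochainComplex B ℤ} {f g : X ⟶ coneId Z}
    (h : ∀ n : ℤ, f.f n ≫ (snd (𝟙 Z)).v n n (add_zero n) =
      g.f n ≫ (snd (𝟙 Z)).v n n (add_zero n)) : f = g := by
  have h' : (Cochain.ofHom f).comp (snd (𝟙 Z)) (add_zero _) =
      (Cochain.ofHom g).comp (snd (𝟙 Z)) (add_zero _) := by
    ext n
    simpa using h n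
  have h'' := congr_arg (δ 0 1) h'
  simp only [δ_ofHom_comp, δ_snd, Cochain.comp_neg, neg_inj, Cochain.comp_id] at h''
  ext n
  rw [ext_to_iff _ n (n + 1) rfl]
  exact ⟨by simpa using Cochain.congr_v h'' n (n + 1) rfl, h n⟩

/-- The morphism between cones of identities induced by a morphism of complexes. -/
noncomputable def coneIdMap {Z Z' : CochainComplex B ℤ} (z : Z ⟶ Z') : coneId Z ⟶ coneId Z' :=
  mappingCone.map (𝟙 Z) (𝟙 Z') z z (by simp)

lemma coneIdMap_snd {Z Z' : CochainComplex B ℤ} (z : Z ⟶ Z') (n : ℤ) :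
    (coneIdMap z).f n ≫ (snd (𝟙 Z')).v n n (add_zero n) =
      (snd (𝟙 Z)).v n n (add_zero n) ≫ z.f n := by
  rw [ext_from_iff _ (n + 1) n rfl]
  simp [coneIdMap, mappingCone.map]

lemma epi_coneIdMap {Z Z' : CochainComplex B ℤ} (z : Z ⟶ Z') [Epi z] : Epi (coneIdMap z) := by
  rw [Preadditive.epi_iff_cancel_zero]
  intro X f hf
  apply coneId_hom_ext
  intro p q hpq
  rw [← cancel_epi (z.f p)]
  have := (inl (𝟙 Z)).v p q hpq ≫= HomologicalComplex.congr_hom hf q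
  simpa [coneIdMap, mappingCone.map] using this

lemma quotient_map_eq_zero_iff_exists_extension {P X : CochainComplex B ℤ} (f : P ⟶ X) :
    (HomotopyCategory.quotient B (ComplexShape.up ℤ)).map f = 0 ↔
      ∃ h : coneId P ⟶ X, coneIdInr P ≫ h = f := by
  rw [HomotopyCategory.quotient_map_eq_zero_iff]
  constructor
  · rintro ⟨h⟩
    have hz := (Cochain.equivHomotopy f 0 h).2
    simp only [Cochain.ofHom_zero, add_zero] at hz
    exact ⟨desc (𝟙 P) _ f (by rw [← hz]; simp), by simp⟩
  · rintro ⟨h, rfl⟩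
    refine ⟨(Cochain.equivHomotopy _ 0).symm
      ⟨(inl (𝟙 P)).comp (Cochain.ofHom h) (add_zero _), ?_⟩⟩
    simp

lemma shortExact_triangleRotateShortComplex (P : CochainComplex B ℤ) :
    (triangleRotateShortComplex (𝟙 P)).ShortExact :=
  HomologicalComplex.shortExact_of_degreewise_shortExact _
    (fun n => (triangleRotateShortComplexSplitting (𝟙 P) n).shortExact)

instance mono_coneIdInr (P : CochainComplex B ℤ) : Mono (coneIdInr P) :=
  (shortExact_triangleRotateShortComplex P).mono_f

/-- The complex with given terms and zero differential. -/
def zeroDiff (A : ℤ → B) : CochainComplex B ℤ where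
  X := A
  d _ _ := 0

lemma projective_coneId {P : CochainComplex B ℤ} (hP : complexesOfProjectives B P) :
    Projective (coneId P) where
  factors {M N} f e _ := by
    have := hP
    obtain ⟨g, hg⟩ := exists_coneId_desc (Z := P) (X := M) (Cochain.mk (fun p q hpq =>
      have := hP p
      Projective.factorThru ((inl (𝟙 P)).v p q hpq ≫ f.f q) (e.f q)))
    refine ⟨g, coneId_hom_ext (fun p q hpq => ?_)⟩
    rw [HomologicalComplex.comp_f, reassoc_of% (hg p q hpq)]
    simp

lemma complexesOfProjectives_coneId {P : CochainComplex B ℤ} (hP : complexesOfProjectives B P) :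
    complexesOfProjectives B (coneId P) := by
  intro n
  have h₁ := hP (n + 1)
  have h₂ := hP n
  refine ⟨fun {M N} f e _ => ⟨(fst (𝟙 P)).1.v n (n + 1) rfl ≫
    Projective.factorThru ((inl (𝟙 P)).v (n + 1) n (by lia) ≫ f) e +
    (snd (𝟙 P)).v n n (add_zero n) ≫ Projective.factorThru ((inr (𝟙 P)).f n ≫ f) e, ?_⟩⟩
  rw [ext_from_iff _ (n + 1) n rfl]
  simp

instance enoughProjectives_cochainComplex [EnoughProjectives B] :
    EnoughProjectives (CochainComplex B ℤ) where
  presentation X := by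
    -- The term of degree `p` covers `X.X (p - 1)`, because maps out of the cone are cochains of
    -- degree -1.
    obtain ⟨A, hA, π, hπ⟩ : ∃ (A : ℤ → B) (_ : ∀ n, Projective (A n))
        (π : ∀ p q : ℤ, p + (-1) = q → ((zeroDiff A).X p ⟶ X.X q)), ∀ p q h, Epi (π p q h) :=
      ⟨fun p => Projective.over (X.X (p + -1)), fun _ => Projective.projective_over _,
        fun p q h => Projective.π (X.X (p + -1)) ≫ eqToHom (congr_arg X.X h),
        fun p q h => epi_comp' (Projective.π_epi _) inferInstance⟩
    obtain ⟨f, hf⟩ := exists_coneId_desc (Z := zeroDiff A) (X := X) (Cochain.mk π)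
    have : Epi f := by
      have (n : ℤ) : Epi (f.f n) := by
        have h := hf (n + 1) n (add_neg_cancel_right n 1)
        rw [Cochain.mk_v] at h
        have := hπ (n + 1) n (add_neg_cancel_right n 1)
        exact epi_of_epi_fac h
      exact HomologicalComplex.epi_of_epi_f _ this
    exact ⟨{ p := _, f := f, projective := projective_coneId (P := zeroDiff A) hA }⟩

lemma contraacyclicComplexes_iff (X : CochainComplex B ℤ) :
    contraacyclicComplexes B X ↔ ∀ P : CochainComplex B ℤ, complexesOfProjectives B P →
      ∀ f : P ⟶ X, ∃ h : coneId P ⟶ X, coneIdInr P ≫ h = f := by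
  simp only [← quotient_map_eq_zero_iff_exists_extension]
  exact ⟨fun h P hP f => h P hP _, fun h P hP f => by
    obtain ⟨f, rfl⟩ := (HomotopyCategory.quotient B (ComplexShape.up ℤ)).map_surjective f
    exact h P hP f⟩

lemma extVanishes_shift_iff {P : CochainComplex B ℤ} (hP : complexesOfProjectives B P)
    (X : CochainComplex B ℤ) :
    ExtVanishes 1 (P⟦(1 : ℤ)⟧) X ↔
      ∀ f : P ⟶ X, ∃ h : coneId P ⟶ X, coneIdInr P ≫ h = f := by
  have hS := shortExact_triangleRotateShortComplex P
  have : Projective (triangleRotateShortComplex (𝟙 P)).X₂ := projective_coneId hP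
  exact ⟨fun h f => h.exists_extension hS f, fun h => extVanishes_one_of_exists_extension hS h⟩

lemma complexesOfProjectives_shift {P : CochainComplex B ℤ} (hP : complexesOfProjectives B P)
    (n : ℤ) : complexesOfProjectives B (P⟦n⟧) :=
  fun i => hP (i + n)

/-- Ext¹ out of `P⟦1⟧` tests maps out of `P`; closure of `S` under shifts in both directions absorbs
the discrepancy. -/
lemma rightExtOrthogonal_iff_of_shift {S : ObjectProperty (CochainComplex B ℤ)}
    (hS : S ≤ complexesOfProjectives B)
    (hS' : ∀ (P : CochainComplex B ℤ) (n : ℤ), S P → S (P⟦n⟧)) (X : CochainComplex B ℤ) :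
    rightExtOrthogonal S X ↔ ∀ P : CochainComplex B ℤ, S P →
      ∀ f : P ⟶ X, ∃ h : coneId P ⟶ X, coneIdInr P ≫ h = f := by
  constructor
  · intro h P hP
    rw [← extVanishes_shift_iff (hS _ hP)]
    exact h _ (hS' _ _ hP)
  · intro h P hP
    exact ((extVanishes_shift_iff (hS _ (hS' _ (-1) hP)) X).2 (h _ (hS' _ _ hP))).of_retract
      (Retract.ofIso (shiftNegShift P (1 : ℤ)).symm)

lemma contraacyclicComplexes_eq :
    contraacyclicComplexes B = rightExtOrthogonal (complexesOfProjectives B) := by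
  ext X
  rw [contraacyclicComplexes_iff, rightExtOrthogonal_iff_of_shift le_rfl
    (fun _ _ h => complexesOfProjectives_shift h _)]

end Cone

/-! ### Complexes of projectives as a left orthogonal class; Eklof's lemma. -/

section Orthogonality

open CochainComplex CochainComplex.HomComplex CochainComplex.mappingCone

variable {B : Type u} [Category.{v} B] [Abelian B]

instance : (complexesOfProjectives B).IsClosedUnderIsomorphisms where
  of_iso e h n := by
    have := h n
    exact Projective.of_iso ((HomologicalComplex.eval B (.up ℤ) n).mapIso e) this

lemma complexesOfProjectives_of_retract {X Y : CochainComplex B ℤ} (r : Retract X Y)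
    (hY : complexesOfProjectives B Y) : complexesOfProjectives B X := fun n => by
  have := hY n
  let r' : Retract (X.X n) (Y.X n) := r.map (HomologicalComplex.eval B (.up ℤ) n)
  exact ⟨fun {M N} f e _ => ⟨r'.i ≫ Projective.factorThru (r'.r ≫ f) e, by simp⟩⟩

instance : (contraacyclicComplexes B).IsClosedUnderIsomorphisms where
  of_iso {X Y} e h := by
    rw [contraacyclicComplexes_iff] at h ⊢
    intro P hP f
    obtain ⟨g, hg⟩ := h P hP (f ≫ e.inv)
    exact ⟨g ≫ e.hom, by simp [reassoc_of% hg]⟩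

/-- The isomorphism between the terms of a cokernel and the cokernels of the terms. -/
noncomputable def cokernelXIso {X Y : CochainComplex B ℤ} (f : X ⟶ Y) (n : ℤ) :
    (cokernel f).X n ≅ cokernel (f.f n) :=
  PreservesCokernel.iso (HomologicalComplex.eval B (.up ℤ) n) f

lemma monosWithCokernelIn_complexesOfProjectives_iff {X Y : CochainComplex B ℤ} (f : X ⟶ Y) :
    monosWithCokernelIn (complexesOfProjectives B) f ↔
      ∀ n : ℤ, (MorphismProperty.epimorphisms B).llp (f.f n) := by
  simp only [monosWithCokernelIn, ObjectProperty.isoClosure_eq_self, epimorphisms_llp_iff]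
  constructor
  · rintro ⟨_, h⟩ n
    exact ⟨inferInstance, Projective.of_iso (cokernelXIso f n) (h n)⟩
  · intro h
    have := fun n => (h n).1
    exact ⟨HomologicalComplex.mono_of_mono_f _ this,
      fun n => Projective.of_iso (cokernelXIso f n).symm (h n).2⟩

lemma monosWithCokernelIn_initial_to_iff {E : Type u} [Category.{v} E] [Abelian E]
    (P : ObjectProperty E) [P.IsClosedUnderIsomorphisms] (X : E) :
    monosWithCokernelIn P (initial.to X) ↔ P X := by
  have h0 : (initial.to X) = 0 := Subsingleton.elim _ _
  have hi : IsZero (⊥_ E) := (isZero_zero E).of_iso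
    (initialIsInitial.uniqueUpToIso HasZeroObject.zeroIsInitial)
  rw [monosWithCokernelIn, ObjectProperty.isoClosure_eq_self, h0,
    P.prop_iff_of_iso cokernelZeroIsoTarget]
  exact and_iff_right (hi.mono _)

lemma monosWithCokernelIn_coneIdInr {P : CochainComplex B ℤ} (hP : complexesOfProjectives B P) :
    monosWithCokernelIn (complexesOfProjectives B) (coneIdInr P) := by
  refine ⟨inferInstance, ObjectProperty.le_isoClosure _ _ ?_⟩
  exact (complexesOfProjectives B).prop_of_iso
    ((shortExact_triangleRotateShortComplex P).gIsCokernel.coconePointUniqueUpToIso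
      (colimit.isColimit (parallelPair (coneIdInr P) 0))) (complexesOfProjectives_shift hP 1)

lemma kernel_mem_of_hasLiftingProperty {X Y : CochainComplex B ℤ} (p : X ⟶ Y)
    (S : ObjectProperty (CochainComplex B ℤ))
    (h : ∀ P, S P → HasLiftingProperty (coneIdInr P) p) (P : CochainComplex B ℤ) (hP : S P)
    (f : P ⟶ kernel p) : ∃ h : coneId P ⟶ kernel p, coneIdInr P ≫ h = f := by
  have := h P hP
  have sq : CommSq (f ≫ kernel.ι p) (coneIdInr P) p 0 := ⟨by simp⟩
  exact ⟨kernel.lift p sq.lift sq.fac_right, by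
    rw [← cancel_mono (kernel.ι p), Category.assoc, kernel.lift_ι, sq.fac_left]⟩

lemma episWithKernelIn_contraacyclic_of_hasLiftingProperty {X Y : CochainComplex B ℤ}
    (p : X ⟶ Y) [Epi p]
    (h : ∀ P, complexesOfProjectives B P → HasLiftingProperty (coneIdInr P) p) :
    episWithKernelIn (contraacyclicComplexes B) p := by
  refine ⟨inferInstance, ObjectProperty.le_isoClosure _ _ ?_⟩
  rw [contraacyclicComplexes_iff]
  exact kernel_mem_of_hasLiftingProperty p _ h

lemma hasLiftingProperty_of_projective_cokernel [EnoughProjectives B]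
    {X Y X' Y' : CochainComplex B ℤ} (i : X ⟶ Y) (p : X' ⟶ Y')
    (hi : monosWithCokernelIn (complexesOfProjectives B) i)
    (hp : episWithKernelIn (contraacyclicComplexes B) p) : HasLiftingProperty i p := by
  rw [monosWithCokernelIn, ObjectProperty.isoClosure_eq_self] at hi
  rw [episWithKernelIn, ObjectProperty.isoClosure_eq_self, contraacyclicComplexes_eq] at hp
  have := hi.1
  have := hp.1
  exact hasLiftingProperty_of_extVanishes i p (hp.2 _ hi.2)

/-- By adjunction, lifting against the cone of `z` is lifting of graded objects, with no
compatibility with differentials to check. -/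
lemma hasLiftingProperty_coneIdMap {X Y Z Z' : CochainComplex B ℤ} (f : X ⟶ Y)
    (z : Z ⟶ Z') (h : ∀ n, HasLiftingProperty (f.f n) (z.f n)) :
    HasLiftingProperty f (coneIdMap z) where
  sq_hasLift {a b} sq := by
    have sq' (n : ℤ) : CommSq (a.f n ≫ (snd (𝟙 _)).v n n (add_zero n)) (f.f n) (z.f n)
        (b.f n ≫ (snd (𝟙 _)).v n n (add_zero n)) := ⟨by
      have := HomologicalComplex.congr_hom sq.w n =≫ (snd (𝟙 _)).v n n (add_zero n)
      simpa [coneIdMap_snd] using this⟩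
    obtain ⟨l, hl⟩ := exists_coneId_lift (Cochain.ofHoms (fun n => (sq' n).lift))
    refine ⟨⟨⟨l, hom_coneId_ext (fun n => ?_), hom_coneId_ext (fun n => ?_)⟩⟩⟩
    · simp [hl]
    · simp only [HomologicalComplex.comp_f, Category.assoc, coneIdMap_snd, reassoc_of% (hl n)]
      simp

lemma hasLiftingProperty_of_coneIdMap {X Y Z Z' : CochainComplex B ℤ} (f : X ⟶ Y)
    (z : Z ⟶ Z') (h : HasLiftingProperty f (coneIdMap z)) (n : ℤ) :
    HasLiftingProperty (f.f n) (z.f n) where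
  sq_hasLift {a b} sq := by
    -- A morphism in the single degree `n` is extended by zero to all degrees.
    have key {T D : CochainComplex B ℤ} (a : T.X n ⟶ D.X n) :
        ∃ β : ∀ m, T.X m ⟶ D.X m, β n = a ∧ ∀ m, m ≠ n → β m = 0 :=
      ⟨fun m => if h : m = n then
        eqToHom (congr_arg T.X h) ≫ a ≫ eqToHom (congr_arg D.X h.symm) else 0, by simp,
        fun m hm => by simp [hm]⟩
    obtain ⟨α, hα, hα'⟩ := key a
    obtain ⟨β, hβ, hβ'⟩ := key b
    obtain ⟨a', ha'⟩ := exists_coneId_lift (Cochain.ofHoms α)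
    obtain ⟨b', hb'⟩ := exists_coneId_lift (Cochain.ofHoms β)
    simp only [Cochain.ofHoms_v] at ha' hb'
    have sq' : CommSq a' f (coneIdMap z) b' := ⟨hom_coneId_ext (fun m => by
      simp only [HomologicalComplex.comp_f, Category.assoc, coneIdMap_snd, reassoc_of% (ha' m),
        hb' m]
      by_cases hm : m = n
      · subst hm
        rw [hα, hβ, sq.w]
      · rw [hα' m hm, hβ' m hm]
        simp)⟩
    refine ⟨⟨⟨sq'.lift.f n ≫ (snd (𝟙 _)).v n n (add_zero n), ?_, ?_⟩⟩⟩
    · rw [← Category.assoc, ← HomologicalComplex.comp_f, sq'.fac_left, ha', hα]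
    · have := HomologicalComplex.congr_hom sq'.fac_right n =≫ (snd (𝟙 _)).v n n (add_zero n)
      rw [hb', hβ, HomologicalComplex.comp_f, Category.assoc, coneIdMap_snd] at this
      simpa using this

lemma episWithKernelIn_coneIdMap {Z Z' : CochainComplex B ℤ} (z : Z ⟶ Z') [Epi z] :
    episWithKernelIn (contraacyclicComplexes B) (coneIdMap z) := by
  have := epi_coneIdMap z
  refine episWithKernelIn_contraacyclic_of_hasLiftingProperty _ (fun P hP => ?_)
  apply hasLiftingProperty_coneIdMap
  intro n
  exact (monosWithCokernelIn_complexesOfProjectives_iff _).1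
    (monosWithCokernelIn_coneIdInr hP) n _ (show Epi _ from inferInstance)

/-- The morphism of complexes with zero differentials which is equal to `p` in each degree. -/
def zeroDiffMap {A A' : B} (p : A ⟶ A') :
    zeroDiff (fun _ => A) ⟶ zeroDiff (fun _ => A') where
  f _ := p
  comm' _ _ _ := comp_zero.trans zero_comp.symm

instance epi_zeroDiffMap {A A' : B} (p : A ⟶ A') [hp : Epi p] : Epi (zeroDiffMap p) :=
  HomologicalComplex.epi_of_epi_f _ (fun _ => hp)

/-- An epimorphism of `B`, placed in every degree with zero differentials, has a cone with
contraacyclic kernel; lifting against these cones detects projectivity degree by degree. -/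
lemma llp_episWithKernelIn_contraacyclicComplexes [EnoughProjectives B] :
    (episWithKernelIn (contraacyclicComplexes B)).llp =
      monosWithCokernelIn (complexesOfProjectives B) := by
  apply le_antisymm
  · intro X Y f hf
    rw [monosWithCokernelIn_complexesOfProjectives_iff]
    intro n A A' p (_ : Epi p)
    exact hasLiftingProperty_of_coneIdMap f _ (hf _ (episWithKernelIn_coneIdMap (zeroDiffMap p))) n
  · intro X Y f hf _ _ p hp
    exact hasLiftingProperty_of_projective_cokernel f p hf hp

lemma complexesOfProjectives_eq [EnoughProjectives B] :
    complexesOfProjectives B = leftExtOrthogonal (contraacyclicComplexes B) := by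
  ext C
  constructor
  · intro hC X hX
    rw [contraacyclicComplexes_eq] at hX
    exact hX C hC
  · intro hC
    rw [← monosWithCokernelIn_initial_to_iff (complexesOfProjectives B),
      ← llp_episWithKernelIn_contraacyclicComplexes]
    rintro X Y p ⟨_, hp⟩
    rw [ObjectProperty.isoClosure_eq_self] at hp
    have : Mono (initial.to C) := (monosWithCokernelIn_initial_to_iff ⊤ C).2 trivial |>.1
    have h0 : (initial.to C) = 0 := Subsingleton.elim _ _
    exact hasLiftingProperty_of_extVanishes _ _
      ((hC _ hp).of_retract (Retract.ofIso (cokernelIsoOfEq h0 ≪≫ cokernelZeroIsoTarget)))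

/-- Eklof's lemma: objects filtered by `S` are left `Ext`-orthogonal to the objects which are right
`Ext`-orthogonal to `S`. -/
lemma extVanishes_of_filteredBy [EnoughProjectives B] {S : ObjectProperty (CochainComplex B ℤ)}
    {N F : CochainComplex B ℤ} (hN : rightExtOrthogonal S N) (hF : filteredBy S F) :
    ExtVanishes 1 F N := by
  -- With `N` fixed, orthogonality to `N` is a left lifting property, and such properties are stable
  -- under transfinite composition.
  let R : MorphismProperty (CochainComplex B ℤ) := fun _ _ p => Epi p ∧ Nonempty (kernel p ≅ N)
  have h₁ : monosWithCokernelIn S ≤ R.llp := by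
    rintro X Y f ⟨_, A, hA, ⟨e⟩⟩ X' Y' p ⟨_, ⟨e'⟩⟩
    exact hasLiftingProperty_of_extVanishes f p
      (((hN A hA).of_retract (Retract.ofIso e)).of_retract_right (Retract.ofIso e'))
  have h₂ := MorphismProperty.transfiniteCompositions_monotone.{v} h₁ _ hF
  have h₃ := MorphismProperty.transfiniteCompositions_le.{v} _ _ h₂
  exact extVanishes_of_hasLiftingProperty (fun X Y p hp he => h₃ p ⟨hp, he⟩)

end Orthogonality

/-! ### Presentable complexes and a projective separator. -/

section Presentable

lemma projective_sigma {B : Type u} [Category.{v} B] {ι : Type*} (X : ι → B) [HasCoproduct X] [∀ i, Projective (X i)] :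
    Projective (∐ X) where
  factors f e _ := ⟨Sigma.desc (fun i => Projective.factorThru (Sigma.ι X i ≫ f) e), by
    apply Sigma.hom_ext
    simp⟩

variable {B : Type u} [Category.{v} B] [Abelian B]

/-- A chain map consists of fewer than `κ` components subject to fewer than `κ` equations, so all of
them are realised at a common stage of a `κ`-filtered diagram. -/
lemma isCardinalPresentable_cochainComplex [HasColimitsOfSize.{v, v} B] (κ : Cardinal.{v})
    [Fact κ.IsRegular] (hκ : HasCardinalLT ℤ κ) (T : CochainComplex B ℤ)
    (hT : ∀ n, IsCardinalPresentable (T.X n) κ) : IsCardinalPresentable T κ where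
  preservesColimitOfShape J _ _ := ⟨fun {D} => ⟨fun {c} hc => by
    have : IsFiltered J := isFiltered_of_isCardinalFiltered J κ
    have hc' (n : ℤ) := isColimitOfPreserves (HomologicalComplex.eval B (.up ℤ) n) hc
    refine ⟨Types.FilteredColimit.isColimitOf' _ _ (fun f => ?_) (fun j f g hfg => ?_)⟩
    · change T ⟶ c.pt at f
      have h₁ (n : ℤ) : ∃ (j : J) (g : T.X n ⟶ (D.obj j).X n), g ≫ (c.ι.app j).f n = f.f n :=
        IsCardinalPresentable.exists_hom_of_isColimit κ (hc' n) (f.f n)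
      choose j g hg using h₁
      let k := IsCardinalFiltered.max (κ := κ) j hκ
      obtain ⟨φ, hφ⟩ : ∃ φ : ∀ n, T.X n ⟶ (D.obj k).X n,
          ∀ n, φ n ≫ (c.ι.app k).f n = f.f n :=
        ⟨fun n => g n ≫ (D.map (IsCardinalFiltered.toMax j hκ n)).f n, fun n => by
          rw [← hg n, Category.assoc, ← HomologicalComplex.comp_f, c.w]⟩
      -- The components `φ n` need not commute with the differentials at stage `k`; each square
      -- commutes only further along, and `wideSpan` finds one stage good for all of them.
      have h₂ (n : ℤ) : ∃ (l : J) (a : k ⟶ l),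
          (φ n ≫ (D.obj k).d n (n + 1)) ≫ (D.map a).f (n + 1) =
            (T.d n (n + 1) ≫ φ (n + 1)) ≫ (D.map a).f (n + 1) := by
        apply IsCardinalPresentable.exists_eq_of_isColimit' κ (hc' (n + 1))
        change (φ n ≫ (D.obj k).d n (n + 1)) ≫ (c.ι.app k).f (n + 1) =
          (T.d n (n + 1) ≫ φ (n + 1)) ≫ (c.ι.app k).f (n + 1)
        rw [Category.assoc, Category.assoc, hφ, ← HomologicalComplex.Hom.comm, ← Category.assoc,
          hφ]
        exact f.comm n (n + 1)
      choose l a ha using h₂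
      obtain ⟨m, e, b, he⟩ := IsCardinalFiltered.wideSpan a hκ
      refine ⟨m, { f := fun n => φ n ≫ (D.map b).f n, comm' := ?_ }, ?_⟩
      · rintro n _ rfl
        have := ha n =≫ (D.map (e n)).f (n + 1)
        simp only [Category.assoc, ← HomologicalComplex.comp_f, ← D.map_comp, he] at this
        rw [← this, Category.assoc, HomologicalComplex.Hom.comm]
      · refine HomologicalComplex.hom_ext _ _ (fun n => ?_)
        change _ = (φ n ≫ (D.map b).f n) ≫ (c.ι.app m).f n
        rw [Category.assoc, ← HomologicalComplex.comp_f, c.w, hφ]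
    · change T ⟶ D.obj j at f g
      change f ≫ c.ι.app j = g ≫ c.ι.app j at hfg
      have h₁ (n : ℤ) : ∃ (k : J) (a : j ⟶ k), f.f n ≫ (D.map a).f n = g.f n ≫ (D.map a).f n :=
        IsCardinalPresentable.exists_eq_of_isColimit' κ (hc' n) _ _
          (HomologicalComplex.congr_hom hfg n)
      choose k a ha using h₁
      obtain ⟨m, e, b, he⟩ := IsCardinalFiltered.wideSpan a hκ
      refine ⟨m, b, ?_⟩
      refine HomologicalComplex.hom_ext _ _ (fun n => ?_)
      change f.f n ≫ (D.map b).f n = g.f n ≫ (D.map b).f n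
      have := ha n =≫ (D.map (e n)).f n
      simpa only [Category.assoc, ← HomologicalComplex.comp_f, ← D.map_comp, he] using this⟩⟩

lemma exists_projective_separator [IsLocallyPresentable.{v} B] [EnoughProjectives B] :
    ∃ (P : B), Projective P ∧ IsSeparator P := by
  obtain ⟨κ, _, _⟩ := IsLocallyPresentable.exists_cardinal.{v} B
  obtain ⟨G, _, hG⟩ := HasCardinalFilteredGenerator.exists_small_generator B κ
  have := hasCoproductsOfShape_of_small.{v} B (Subtype G)
  have hG' := Preadditive.isSeparating_iff _ |>.1 hG.isStrongGenerator.isSeparating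
  refine ⟨∐ fun X : Subtype G => Projective.over X.1, projective_sigma _, ?_⟩
  rw [Preadditive.isSeparator_iff]
  intro X Y f hf
  refine hG' f (fun G hG h => ?_)
  -- The test map is `h` composed with the projective cover on the summand `G`, and zero on the
  -- others.
  have := Sigma.ι _ ⟨G, hG⟩ ≫= hf (Sigma.desc (fun X' : Subtype _ => by
    classical
    exact if hX : X'.1 = G then Projective.π X'.1 ≫ eqToHom hX ≫ h else 0))
  rw [← cancel_epi (Projective.π G)]
  simpa using this

end Presentable

/-! ### The generating cofibrations and the small object argument. -/

section Generators

lemma isCardinalPresentable_sigma {B : Type u} [Category.{v} B] [HasColimitsOfSize.{v, v} B]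
    {P : B} {κ : Cardinal.{v}} [Fact κ.IsRegular] [IsCardinalPresentable P κ]
    {Z : Type v} (hZ : HasCardinalLT Z κ) : IsCardinalPresentable (∐ fun _ : Z => P) κ := by
  have (k : Discrete Z) : IsCardinalPresentable ((Discrete.functor fun _ : Z => P).obj k) κ := by
    dsimp
    infer_instance
  exact isCardinalPresentable_of_isColimit _ (coproductIsCoproduct (fun _ : Z => P)) κ
    (by simpa using hZ)

open CochainComplex CochainComplex.HomComplex CochainComplex.mappingCone

variable {B : Type u} [Category.{v} B] [Abelian B] [HasColimitsOfSize.{v, v} B]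

/-- Coproducts of less than `κ` copies of `P` (a set of representatives). -/
def smallCoproducts (κ : Cardinal.{v}) (P : B) : ObjectProperty B :=
  ObjectProperty.ofObj (fun Z : { Z : Set κ.ord.ToType // HasCardinalLT Z κ } =>
    ∐ fun _ : Z.1 => P)

/-- The complexes whose terms are coproducts of less than `κ` copies of `P`. -/
def smallComplexes (κ : Cardinal.{v}) (P : B) : ObjectProperty (CochainComplex B ℤ) :=
  fun T => ∀ n, smallCoproducts κ P (T.X n)

/-- The inclusions of the complexes in `smallComplexes κ P` into their cones, and the inclusion of
zero in the cone of a complex with terms `P`. -/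
def generatingCofibrations (κ : Cardinal.{v}) (P : B) : MorphismProperty (CochainComplex B ℤ) :=
  MorphismProperty.ofHoms (fun T : Subtype (smallComplexes κ P) => coneIdInr T.1) ⊔
    MorphismProperty.ofHoms (fun _ : Unit => initial.to (coneId (zeroDiff (fun _ => P))))

variable (κ : Cardinal.{v}) (P : B)

instance small_smallCoproducts : ObjectProperty.Small.{v} (smallCoproducts κ P) := by
  unfold smallCoproducts
  infer_instance

instance small_smallComplexes : ObjectProperty.Small.{v} (smallComplexes κ P) := by
  let f : (Σ X : ℤ → Subtype (smallCoproducts κ P),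
      { d : ∀ i j, (X i).1 ⟶ (X j).1 // (∀ i j, ¬ (ComplexShape.up ℤ).Rel i j → d i j = 0) ∧
        ∀ i j k, (ComplexShape.up ℤ).Rel i j → (ComplexShape.up ℤ).Rel j k →
          d i j ≫ d j k = 0 }) → Subtype (smallComplexes κ P) := fun X =>
    ⟨{  X := fun i => (X.1 i).1
        d := X.2.1
        shape := X.2.2.1
        d_comp_d' := X.2.2.2 }, fun i => (X.1 i).2⟩
  refine small_of_surjective (f := f) (fun T => ?_)
  exact ⟨⟨fun i => ⟨T.1.X i, T.2 i⟩, ⟨T.1.d, T.1.shape, T.1.d_comp_d'⟩⟩, rfl⟩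

instance isSmall_sup {C : Type*} [Category* C] (W₁ W₂ : MorphismProperty C)
    [MorphismProperty.IsSmall.{v} W₁] [MorphismProperty.IsSmall.{v} W₂] :
    MorphismProperty.IsSmall.{v} (W₁ ⊔ W₂) := by
  rw [sup_eq_iSup]
  have (b : Bool) : MorphismProperty.IsSmall.{v} (bif b then W₁ else W₂) := by
    cases b <;> dsimp <;> infer_instance
  infer_instance

instance isSmall_generatingCofibrations :
    MorphismProperty.IsSmall.{v} (generatingCofibrations κ P) := by
  have : Small.{v} (Subtype (smallComplexes κ P)) := small_smallComplexes κ P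
  unfold generatingCofibrations
  infer_instance

variable {κ P}

lemma smallComplexes_le [Projective P] : smallComplexes κ P ≤ complexesOfProjectives B := by
  intro T hT n
  have := hT n
  generalize T.X n = X at this
  obtain ⟨Z⟩ := this
  exact projective_sigma _

lemma smallComplexes_shift (T : CochainComplex B ℤ) (n : ℤ) (hT : smallComplexes κ P T) :
    smallComplexes κ P (T⟦n⟧) :=
  fun i => hT (i + n)

lemma isCardinalPresentable_of_smallComplexes [Fact κ.IsRegular] [IsCardinalPresentable P κ]
    (hκ : HasCardinalLT ℤ κ) {T : CochainComplex B ℤ} (hT : smallComplexes κ P T) :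
    IsCardinalPresentable T κ := by
  refine isCardinalPresentable_cochainComplex κ hκ T (fun n => ?_)
  have := hT n
  generalize T.X n = X at this
  obtain ⟨Z, hZ⟩ := this
  exact isCardinalPresentable_sigma hZ

lemma isCardinalPresentable_of_isInitial {C : Type*} [Category.{v} C] [LocallySmall.{v} C]
    (κ : Cardinal.{v}) [Fact κ.IsRegular] {X : C} (hX : IsInitial X) : IsCardinalPresentable X κ := by
  have (k : Discrete PEmpty.{1}) : IsCardinalPresentable ((Functor.empty C).obj k) κ := k.as.elim
  exact isCardinalPresentable_of_isColimit _ hX κ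
    (hasCardinalLT_of_finite _ _ (Fact.out : κ.IsRegular).aleph0_le)

lemma hasSmallObjectArgument_generatingCofibrations [Fact κ.IsRegular] [IsCardinalPresentable P κ]
    (hκ : HasCardinalLT ℤ κ) :
    MorphismProperty.HasSmallObjectArgument.{v} (generatingCofibrations κ P) := by
  let _ : OrderBot κ.ord.ToType := by
    have : Nonempty κ.ord.ToType := by
      rw [← Cardinal.mk_ne_zero_iff]
      simpa using (Fact.out : κ.IsRegular).pos.ne'
    exact WellFoundedLT.toOrderBot _
  refine ⟨κ, inferInstance, inferInstance, ?_⟩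
  have : HasIterationOfShape κ.ord.ToType (CochainComplex B ℤ) := { }
  refine { preservesColimit := fun {A A' X Y} i hi f hf => ?_ }
  have : IsCardinalPresentable A κ := by
    rcases hi with hi | hi
    · obtain ⟨T, hT⟩ := hi
      exact isCardinalPresentable_of_smallComplexes hκ hT
    · obtain ⟨_⟩ := hi
      exact isCardinalPresentable_of_isInitial κ initialIsInitial
  have := preservesColimitsOfShape_of_isCardinalPresentable A κ κ.ord.ToType
  infer_instance

/-- Any `P ⟶ Y.X n` is a component of a chain map from this cone, so lifting makes it factor through
`p.f n`; a separator then detects that `p.f n` is epi. -/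
lemma epi_of_hasLiftingProperty (hP : IsSeparator P) {X Y : CochainComplex B ℤ} (p : X ⟶ Y)
    (h : HasLiftingProperty (initial.to (coneId (zeroDiff (fun _ => P)))) p) : Epi p := by
  refine HomologicalComplex.epi_of_epi_f _ (fun n => ?_)
  rw [Preadditive.epi_iff_cancel_zero]
  intro Z φ hφ
  refine (Preadditive.isSeparator_iff P).1 hP φ
    (fun (g : (zeroDiff (fun _ => P)).X (n + 1) ⟶ Y.X n) => ?_)
  change g ≫ φ = 0
  obtain ⟨α, hα⟩ : ∃ α : ∀ p q : ℤ, p + (-1) = q → ((zeroDiff (fun _ => P)).X p ⟶ Y.X q),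
      α (n + 1) n (add_neg_cancel_right n 1) = g :=
    ⟨fun p q _ => if hq : n = q then g ≫ eqToHom (congr_arg Y.X hq) else 0, by simp⟩
  obtain ⟨b, hb⟩ := exists_coneId_desc (Cochain.mk α)
  have hb' := hb (n + 1) n (add_neg_cancel_right n 1)
  rw [Cochain.mk_v, hα] at hb'
  have sq : CommSq (initial.to X) (initial.to (coneId (zeroDiff (fun _ => P)))) p b :=
    ⟨Subsingleton.elim _ _⟩
  have := HomologicalComplex.congr_hom sq.fac_right n
  rw [← hb', ← this, HomologicalComplex.comp_f, Category.assoc, Category.assoc, hφ, comp_zero,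
    comp_zero]

lemma rlp_generatingCofibrations [EnoughProjectives B] [Projective P] (hP : IsSeparator P)
    (h : rightExtOrthogonal (smallComplexes κ P) = contraacyclicComplexes B) :
    (generatingCofibrations κ P).rlp = episWithKernelIn (contraacyclicComplexes B) := by
  apply le_antisymm
  · intro X Y p hp
    have : Epi p := epi_of_hasLiftingProperty hP p (hp _ (Or.inr (MorphismProperty.ofHoms.mk ())))
    refine ⟨this, ObjectProperty.le_isoClosure _ _ ?_⟩
    rw [← h, rightExtOrthogonal_iff_of_shift smallComplexes_le
      (fun T n hT => smallComplexes_shift T n hT)]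
    exact kernel_mem_of_hasLiftingProperty p _ (fun T hT => hp _ (Or.inl
      (MorphismProperty.ofHoms.mk (f := fun T : Subtype (smallComplexes κ P) => coneIdInr T.1)
        ⟨T, hT⟩)))
  · rw [← MorphismProperty.le_llp_iff_le_rlp, llp_episWithKernelIn_contraacyclicComplexes]
    intro X Y i hi
    rcases hi with hi | hi
    · obtain ⟨T, hT⟩ := hi
      exact monosWithCokernelIn_coneIdInr (smallComplexes_le _ hT)
    · obtain ⟨_⟩ := hi
      rw [monosWithCokernelIn_initial_to_iff]
      exact complexesOfProjectives_coneId (fun _ => (inferInstance : Projective P))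

end Generators

/-! ### Copowers of an object indexed by subsets. -/

section Copower

variable {B : Type u} [Category.{v} B] [HasColimitsOfSize.{v, v} B] {Y : Type v}

/-- The functor sending a subset `U` of `Y` to the coproduct of copies of `P` indexed by `U`. -/
noncomputable def copower (Y : Type v) (P : B) : Set Y ⥤ B where
  obj U := ∐ fun _ : U => P
  map {_ V} f := Sigma.desc (fun y => Sigma.ι (fun _ : V => P) ⟨y.1, leOfHom f y.2⟩)
  map_id _ := by apply Sigma.hom_ext; simp
  map_comp _ _ := by apply Sigma.hom_ext; simp

variable {P : B}

/-- The inclusion of `P` in the summand of `(copower Y P).obj U` corresponding to `y ∈ U`. -/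
noncomputable def copowerι (P : B) {U : Set Y} (y : Y) (hy : y ∈ U) : P ⟶ (copower Y P).obj U :=
  Sigma.ι (fun _ : U => P) ⟨y, hy⟩

@[simp]
lemma copowerι_map {U V : Set Y} (f : U ⟶ V) (y : Y) (hy : y ∈ U) :
    copowerι P y hy ≫ (copower Y P).map f = copowerι P y (leOfHom f hy) :=
  Sigma.ι_desc _ _

lemma copower_hom_ext {U : Set Y} {Z : B} {f g : (copower Y P).obj U ⟶ Z}
    (h : ∀ y hy, copowerι P y hy ≫ f = copowerι P y hy ≫ g) : f = g :=
  Sigma.hom_ext _ _ (fun y => h y.1 y.2)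

/-- Reassociated version of `copowerι_map`. -/
lemma copowerι_map_assoc {U V : Set Y} (f : U ⟶ V) (y : Y) (hy : y ∈ U) {Z : B}
    (g : (copower Y P).obj V ⟶ Z) :
    copowerι P y hy ≫ (copower Y P).map f ≫ g = copowerι P y (leOfHom f hy) ≫ g := by
  rw [← Category.assoc, copowerι_map]

/-- Constructor for morphisms from `(copower Y P).obj U`. -/
noncomputable def copowerDesc {U : Set Y} {Z : B} (φ : ∀ y ∈ U, P ⟶ Z) :
    (copower Y P).obj U ⟶ Z :=
  Sigma.desc (fun y => φ y.1 y.2)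

@[simp]
lemma copowerι_desc {U : Set Y} {Z : B} (φ : ∀ y ∈ U, P ⟶ Z) (y : Y) (hy : y ∈ U) :
    copowerι P y hy ≫ copowerDesc φ = φ y hy :=
  Sigma.ι_desc _ _

/-- Reassociated version of `copowerι_desc`. -/
lemma copowerι_desc_assoc {U : Set Y} {Z Z' : B} (φ : ∀ y ∈ U, P ⟶ Z) (y : Y) (hy : y ∈ U)
    (g : Z ⟶ Z') : copowerι P y hy ≫ copowerDesc φ ≫ g = φ y hy ≫ g := by
  rw [← Category.assoc, copowerι_desc]

lemma nonempty_isColimit_copower {J : Type*} [Category* J] [IsFiltered J] {D : J ⥤ Set Y}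
    (c : Cocone D) (hc : ∀ y ∈ c.pt, ∃ j, y ∈ D.obj j) :
    Nonempty (IsColimit ((copower Y P).mapCocone c)) := by
  choose j hj using hc
  -- Filteredness makes the value on a summand independent of the chosen stage containing it.
  have key (s : Cocone (D ⋙ copower Y P)) (i : J) (y : Y) (hy : y ∈ c.pt) (hi : y ∈ D.obj i) :
      copowerι P y (hj y hy) ≫ s.ι.app (j y hy) = copowerι P y hi ≫ s.ι.app i := by
    rw [← s.w (IsFiltered.leftToMax (j y hy) i), ← s.w (IsFiltered.rightToMax (j y hy) i)]
    dsimp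
    rw [copowerι_map_assoc, copowerι_map_assoc]
  refine ⟨{
    desc s := copowerDesc (fun y hy => copowerι P y (hj y hy) ≫ s.ι.app (j y hy))
    fac s i := ?_
    uniq s m hm := ?_ }⟩
  · refine copower_hom_ext (fun y hy => ?_)
    dsimp
    rw [copowerι_map_assoc, copowerι_desc]
    exact key s i y _ hy
  · refine copower_hom_ext (fun y hy => ?_)
    dsimp at m hm ⊢
    rw [copowerι_desc, ← hm, copowerι_map_assoc]

-- By regularity of `κ`, the subsets of size less than `κ` form a `κ`-directed poset, and the full
-- copower is the colimit over it.
variable (P) in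
lemma exists_factorization_through_copower {κ : Cardinal.{v}} [Fact κ.IsRegular]
    [IsCardinalPresentable P κ] (f : P ⟶ (copower Y P).obj Set.univ) :
    ∃ (A : Set Y) (_ : HasCardinalLT A κ) (g : P ⟶ (copower Y P).obj A),
      g ≫ (copower Y P).map (homOfLE (Set.subset_univ A)) = f := by
  have hκ : Cardinal.aleph0 ≤ κ := (Fact.out : κ.IsRegular).aleph0_le
  let J := { A : Set Y // HasCardinalLT A κ }
  have : IsCardinalFiltered J κ := isCardinalFiltered_preorder _ _ (fun ι a hι =>
    ⟨⟨⋃ i, (a i).1, hasCardinalLT_iUnion _ (by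
      rwa [hasCardinalLT_iff_cardinal_mk_lt]) (fun i => (a i).2)⟩,
      fun i => Set.subset_iUnion (fun i => (a i).1) i⟩)
  have : IsFiltered J := isFiltered_of_isCardinalFiltered J κ
  let D : J ⥤ Set Y := Monotone.functor (f := fun A : J => A.1) (fun _ _ h => h)
  let c : Cocone D := { pt := Set.univ, ι := { app A := homOfLE (Set.subset_univ _) } }
  obtain ⟨hc⟩ := nonempty_isColimit_copower (P := P) c (fun y _ =>
    ⟨⟨{y}, hasCardinalLT_of_finite _ _ hκ⟩, rfl⟩)
  obtain ⟨A, g, hg⟩ := IsCardinalPresentable.exists_hom_of_isColimit κ hc f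
  exact ⟨A.1, A.2, g, hg⟩

end Copower

/-! ### Projections between copowers and cokernels of inclusions. -/

section Preadditive

variable {B : Type u} [Category.{v} B] [HasColimitsOfSize.{v, v} B] [HasZeroMorphisms B]
  {Y : Type v} {P : B}

/-- The projection from a copower to a copower with a smaller index set. -/
noncomputable def copowerProj (U V : Set Y) : (copower Y P).obj V ⟶ (copower Y P).obj U := by
  classical
  exact copowerDesc (fun y _ => if h : y ∈ U then copowerι P y h else 0)

lemma copowerι_proj {U V : Set Y} (y : Y) (hy : y ∈ V) (hy' : y ∈ U) :
    copowerι P y hy ≫ copowerProj U V = copowerι P y hy' := by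
  simp [copowerProj, hy']

lemma copowerι_proj_eq_zero {U V : Set Y} (y : Y) (hy : y ∈ V) (hy' : y ∉ U) :
    copowerι P y hy ≫ copowerProj U V = 0 := by
  simp [copowerProj, hy']

instance mono_copower_map {U V : Set Y} (f : U ⟶ V) : Mono ((copower Y P).map f) := by
  have : (copower Y P).map f ≫ copowerProj U V = 𝟙 _ := copower_hom_ext (fun y hy => by
    rw [copowerι_map_assoc, copowerι_proj _ _ hy, Category.comp_id])
  exact mono_of_mono_fac this

lemma copower_map_proj_diff {U V : Set Y} (f : U ⟶ V) :
    (copower Y P).map f ≫ copowerProj (V \ U) V = 0 :=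
  copower_hom_ext (fun y hy => by
    rw [copowerι_map_assoc, copowerι_proj_eq_zero _ _ (fun h => h.2 hy), comp_zero])

/-- The cokernel of the inclusion of a copower into a copower with a bigger index set. -/
noncomputable def isColimitCopowerProj {U V : Set Y} (f : U ⟶ V) :
    IsColimit (CokernelCofork.ofπ _ (copower_map_proj_diff (P := P) f)) :=
  CokernelCofork.IsColimit.ofπ _ _
    (fun g _ => (copower Y P).map (homOfLE Set.sdiff_subset) ≫ g)
    (fun g hg => copower_hom_ext (fun y hy => by
      by_cases hy' : y ∈ U
      · have := copowerι P y hy' ≫= hg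
        rw [copowerι_map_assoc, comp_zero] at this
        rw [← Category.assoc, copowerι_proj_eq_zero _ _ (fun h => h.2 hy'), zero_comp, this]
      · rw [← Category.assoc, copowerι_proj (U := V \ U) y hy (show y ∈ V \ U from ⟨hy, hy'⟩),
          copowerι_map_assoc]))
    (fun g hg m hm => copower_hom_ext (fun y hy => by
      rw [← hm, copowerι_map_assoc, ← Category.assoc, copowerι_proj (U := V \ U) y hy.1 hy]))

end Preadditive

/-! ### Index sets stable under a family of endomorphisms. -/

section Stable

variable {B : Type u} [Category.{v} B] [HasColimitsOfSize.{v, v} B]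
  {Y : Type v} {P : B} (d : ℤ → ((copower Y P).obj Set.univ ⟶ (copower Y P).obj Set.univ))

/-- The subsets `U` of `Y` such that `(copower Y P).obj U` is stable under the endomorphisms
`d n`. -/
def IsStable (U : Set Y) : Prop :=
  ∀ n, ∃ e : (copower Y P).obj U ⟶ (copower Y P).obj U,
    e ≫ (copower Y P).map (homOfLE (Set.subset_univ U)) =
      (copower Y P).map (homOfLE (Set.subset_univ U)) ≫ d n

variable {d}

lemma isStable_of_forall_mem {U : Set Y}
    (h : ∀ y ∈ U, ∀ n, ∃ φ : P ⟶ (copower Y P).obj U,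
      φ ≫ (copower Y P).map (homOfLE (Set.subset_univ U)) =
        copowerι P y (Set.mem_univ y) ≫ d n) : IsStable d U := fun n => by
  choose φ hφ using h
  exact ⟨copowerDesc (fun y hy => φ y hy n), copower_hom_ext (fun y hy => by
    rw [copowerι_desc_assoc, copowerι_map_assoc, hφ])⟩

lemma isStable_iUnion {ι : Sort*} {U : ι → Set Y} (h : ∀ i, IsStable d (U i)) :
    IsStable d (⋃ i, U i) := by
  refine isStable_of_forall_mem (fun y hy n => ?_)
  obtain ⟨i, hi⟩ := Set.mem_iUnion.1 hy
  obtain ⟨e, he⟩ := h i n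
  refine ⟨copowerι P y hi ≫ e ≫ (copower Y P).map (homOfLE (Set.subset_iUnion U i)), ?_⟩
  have : (copower Y P).map (homOfLE (Set.subset_iUnion U i)) ≫
      (copower Y P).map (homOfLE (Set.subset_univ _)) =
        (copower Y P).map (homOfLE (Set.subset_univ _)) := by
    rw [← Functor.map_comp]; rfl
  rw [Category.assoc, Category.assoc, this, he, copowerι_map_assoc]

lemma isStable_univ : IsStable d Set.univ :=
  isStable_of_forall_mem (fun y _ n => ⟨copowerι P y (Set.mem_univ y) ≫ d n, by
    have : (copower Y P).map (homOfLE (Set.subset_univ Set.univ)) = 𝟙 _ :=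
      (copower Y P).map_id _
    rw [this, Category.comp_id]⟩)

variable (d) in
lemma exists_isStable_mem {κ : Cardinal.{v}} [Fact κ.IsRegular] [IsCardinalPresentable P κ]
    (hκ : HasCardinalLT ℤ κ) (y : Y) :
    ∃ U : Set Y, IsStable d U ∧ HasCardinalLT U κ ∧ y ∈ U := by
  have h (n : ℤ) (z : Y) := exists_factorization_through_copower (κ := κ) P
    (copowerι P z (Set.mem_univ z) ≫ d n)
  choose A hA g hg using h
  -- `A n z` supports the image under `d n` of the summand `z`. Each step collects the supports of
  -- the previous one, so the union over `k` is stable; it stays below `κ`, which is regular and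
  -- uncountable.
  let U (k : ℕ) : Set Y := Nat.rec (motive := fun _ => Set Y) {y} (fun _ V => ⋃ z : V, ⋃ n, A n z.1) k
  have hU (k : ℕ) : HasCardinalLT (U k : Set Y) κ := by
    induction k with
    | zero => exact hasCardinalLT_of_finite ({y} : Set Y) _ (Fact.out : κ.IsRegular).aleph0_le
    | succ k hk =>
      exact hasCardinalLT_iUnion _ hk (fun z => hasCardinalLT_iUnion _ hκ (fun n => hA n z.1))
  refine ⟨⋃ k, U k, isStable_of_forall_mem (fun z hz n => ?_),
    hasCardinalLT_iUnion _ (hκ.of_injective _ Nat.cast_injective) hU,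
    Set.mem_iUnion.2 ⟨0, rfl⟩⟩
  obtain ⟨k, hk⟩ := Set.mem_iUnion.1 hz
  have hle : A n z ⊆ ⋃ k, U k := by
    refine subset_trans ?_ (Set.subset_iUnion U (k + 1))
    exact fun w hw => Set.mem_iUnion.2 ⟨⟨z, hk⟩, Set.mem_iUnion.2 ⟨n, hw⟩⟩
  refine ⟨g n z ≫ (copower Y P).map (homOfLE hle), ?_⟩
  rw [Category.assoc, ← Functor.map_comp, ← hg]
  rfl

end Stable

/-! ### Complexes on stable index sets and their filtrations. -/

section StableComplex

variable {B : Type u} [Category.{v} B] [Abelian B] [HasColimitsOfSize.{v, v} B]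
  {Y : Type v} {P : B} {d : ℤ → ((copower Y P).obj Set.univ ⟶ (copower Y P).obj Set.univ)}

omit [Abelian B] in
lemma copower_map_comp_map_univ {U V : Set Y} (f : U ⟶ V) :
    (copower Y P).map f ≫ (copower Y P).map (homOfLE (Set.subset_univ V)) =
      (copower Y P).map (homOfLE (Set.subset_univ U)) := by
  rw [← Functor.map_comp]; rfl

/-- The endomorphism of `(copower Y P).obj U` induced by `d n` when `U` is stable. -/
noncomputable def stableDiff {U : Set Y} (hU : IsStable d U) (n : ℤ) :
    (copower Y P).obj U ⟶ (copower Y P).obj U :=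
  (hU n).choose

omit [Abelian B] in
lemma stableDiff_comp_map {U : Set Y} (hU : IsStable d U) (n : ℤ) :
    stableDiff hU n ≫ (copower Y P).map (homOfLE (Set.subset_univ U)) =
      (copower Y P).map (homOfLE (Set.subset_univ U)) ≫ d n :=
  (hU n).choose_spec

omit [Abelian B] in
lemma stableDiff_univ (n : ℤ) : stableDiff (d := d) isStable_univ n = d n := by
  have h := stableDiff_comp_map (d := d) isStable_univ n
  have h' : (copower Y P).map (homOfLE (Set.subset_univ Set.univ)) = 𝟙 _ :=
    (copower Y P).map_id _
  rwa [h', Category.comp_id, Category.id_comp] at h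

/-- The complexes with terms `(copower Y P).obj U` attached to the stable subsets `U` of `Y`. -/
noncomputable def stableComplex (hd : ∀ n, d n ≫ d (n + 1) = 0) :
    { U : Set Y // IsStable d U } ⥤ CochainComplex B ℤ where
  obj U := CochainComplex.of (fun _ => (copower Y P).obj U.1) (stableDiff U.2) (fun n => by
    rw [← cancel_mono ((copower Y P).map (homOfLE (Set.subset_univ U.1))), Category.assoc,
      stableDiff_comp_map, ← Category.assoc, stableDiff_comp_map, Category.assoc, hd, comp_zero,
      zero_comp])
  map {U V} f := CochainComplex.ofHom (fun _ => (copower Y P).map (homOfLE (leOfHom f)))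
    (fun n => by
      dsimp only
      rw [CochainComplex.of_d, CochainComplex.of_d,
        ← cancel_mono ((copower Y P).map (homOfLE (Set.subset_univ V.1))), Category.assoc,
        stableDiff_comp_map, Category.assoc, copower_map_comp_map_univ, stableDiff_comp_map,
        ← Category.assoc, copower_map_comp_map_univ])
  map_id U := by
    ext n
    exact (copower Y P).map_id U.1
  map_comp f g := by
    ext n
    exact (copower Y P).map_comp (homOfLE (leOfHom f)) (homOfLE (leOfHom g))

variable (hd : ∀ n, d n ≫ d (n + 1) = 0)

lemma nonempty_isColimit_stableComplex {J : Type*} [Category* J] [IsFiltered J]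
    {D : J ⥤ { U : Set Y // IsStable d U }} (c : Cocone D)
    (hc : ∀ y ∈ c.pt.1, ∃ j, y ∈ (D.obj j).1) :
    Nonempty (IsColimit ((stableComplex hd).mapCocone c)) := by
  obtain ⟨h⟩ := nonempty_isColimit_copower (P := P)
    (((Subtype.mono_coe (IsStable d)).functor).mapCocone c) hc
  exact ⟨HomologicalComplex.isColimitOfEval _ _ (fun n => h)⟩

lemma isZero_stableComplex {U : { U : Set Y // IsStable d U }} (hU : ∀ y, y ∉ U.1) :
    IsZero ((stableComplex hd).obj U) := by
  rw [IsZero.iff_id_eq_zero]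
  ext n
  exact copower_hom_ext (P := P) (fun y hy => (hU y hy).elim)

omit [Abelian B] in
lemma smallCoproducts_isoClosure_copower {κ : Cardinal.{v}} {U : Set Y} (hU : HasCardinalLT U κ) :
    (smallCoproducts κ P).isoClosure ((copower Y P).obj U) := by
  have h : Cardinal.mk U ≤ Cardinal.mk κ.ord.ToType := by
    rw [Cardinal.mk_ord_toType]
    exact ((hasCardinalLT_iff_cardinal_mk_lt _ _).1 hU).le
  obtain ⟨e⟩ := h
  let eq := Equiv.ofInjective e e.injective
  exact ⟨_, .mk (⟨Set.range e, (hasCardinalLT_iff_of_equiv eq κ).1 hU⟩ :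
    { Z : Set κ.ord.ToType // HasCardinalLT Z κ }),
    ⟨Sigma.whiskerEquiv (f := fun _ : U => P) (g := fun _ : Set.range e => P) eq
      (fun _ => Iso.refl P)⟩⟩

lemma smallComplexes_isoClosure {κ : Cardinal.{v}} {X : CochainComplex B ℤ}
    (h : ∀ n, (smallCoproducts κ P).isoClosure (X.X n)) :
    (smallComplexes κ P).isoClosure X := by
  choose A hA e using h
  replace e := fun n => (e n).some
  exact ⟨{
      X := A
      d i j := (e i).inv ≫ X.d i j ≫ (e j).hom
      shape i j hij := by simp [X.shape i j hij] },
    hA, ⟨HomologicalComplex.Hom.isoOfComponents e (by simp)⟩⟩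

lemma monosWithCokernelIn_stableComplex_map {κ : Cardinal.{v}}
    {U V : { U : Set Y // IsStable d U }} (f : U ⟶ V)
    (h : HasCardinalLT (V.1 \ U.1 : Set Y) κ) :
    monosWithCokernelIn (smallComplexes κ P) ((stableComplex hd).map f) := by
  have (n : ℤ) : Mono (((stableComplex hd).map f).f n) :=
    mono_copower_map (homOfLE (leOfHom f))
  refine ⟨HomologicalComplex.mono_of_mono_f _ this, smallComplexes_isoClosure (fun n => ?_)⟩
  exact (smallCoproducts κ P).isoClosure.prop_of_iso
    ((cokernelXIso _ n ≪≫ (cokernelIsCokernel _).coconePointUniqueUpToIso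
      (isColimitCopowerProj (P := P) (homOfLE (leOfHom f))))).symm
    (smallCoproducts_isoClosure_copower h)

lemma filteredBy_stableComplex {κ : Cardinal.{v}} [Fact κ.IsRegular] [IsCardinalPresentable P κ]
    (hκ : HasCardinalLT ℤ κ) :
    filteredBy (smallComplexes κ P) ((stableComplex hd).obj ⟨Set.univ, isStable_univ⟩) := by
  choose cl hcl hcl' hcl'' using exists_isStable_mem d hκ
  obtain ⟨_, _⟩ := exists_wellFoundedLT Y
  let J := WithTop Y
  let _ : OrderBot J := WellFoundedLT.toOrderBot _
  let _ : SuccOrder J := SuccOrder.ofLinearWellFoundedLT _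
  -- Strict inequality makes `G` empty at the bottom and continuous at limits; adjoining a top
  -- element makes the chain reach all of `Y`. The step from `y` to its successor adds only indices
  -- from `cl y`.
  let G (j : J) : { U : Set Y // IsStable d U } :=
    ⟨⋃ y : { y : Y // (y : J) < j }, cl y.1, isStable_iUnion (fun y => hcl y.1)⟩
  have mem_G (z : Y) (j : J) : z ∈ (G j).1 ↔ ∃ y : Y, (y : J) < j ∧ z ∈ cl y := by
    simp [G]
  have hG : Monotone G := fun j j' h z hz => by
    rw [mem_G] at hz ⊢
    obtain ⟨y, hy, hz⟩ := hz
    exact ⟨y, hy.trans_le h, hz⟩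
  let c : Cocone hG.functor :=
    { pt := ⟨Set.univ, isStable_univ⟩
      ι := { app j := homOfLE (Set.subset_univ _) } }
  obtain ⟨hc⟩ := nonempty_isColimit_stableComplex hd c (fun y _ =>
    ⟨⊤, (mem_G _ _).2 ⟨y, WithTop.coe_lt_top y, hcl'' y⟩⟩)
  have hcont : (hG.functor ⋙ stableComplex hd).IsWellOrderContinuous := ⟨fun m hm => by
    have : Nonempty (Set.Iio m) := ⟨⊥, hm.bot_lt⟩
    exact nonempty_isColimit_stableComplex hd ((Set.principalSegIio m).cocone hG.functor)
      (fun z hz => by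
        obtain ⟨y, hy, hz⟩ := (mem_G _ _).1 hz
        obtain ⟨j, hj, hj'⟩ := hm.isSuccPrelimit.lt_iff_exists_lt.1 hy
        exact ⟨⟨j, hj⟩, (mem_G _ _).2 ⟨y, hj', hz⟩⟩)⟩
  have hbot : IsZero ((hG.functor ⋙ stableComplex hd).obj ⊥) :=
    isZero_stableComplex hd (fun z hz => by
      obtain ⟨y, hy, _⟩ := (mem_G _ _).1 hz
      exact not_lt_bot hy)
  refine MorphismProperty.transfiniteCompositionsOfShape_le_transfiniteCompositions.{v} _ J _ ⟨{
      F := hG.functor ⋙ stableComplex hd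
      isoBot := hbot.iso (IsInitial.isZero initialIsInitial)
      isWellOrderContinuous := hcont
      incl := ((stableComplex hd).mapCocone c).ι
      isColimit := hc
      fac := Subsingleton.elim _ _
      map_mem j hj := ?_ }⟩
  refine monosWithCokernelIn_stableComplex_map hd (hG.functor.map (homOfLE (Order.le_succ j))) ?_
  obtain ⟨y, rfl⟩ := WithTop.ne_top_iff_exists.1 (show j ≠ ⊤ from fun h => hj (h ▸ isMax_top))
  refine (hcl' y).of_injective (fun z => ⟨z.1, ?_⟩) (fun z z' h => Subtype.ext (by simpa using h))
  obtain ⟨z, hz, hz'⟩ := z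
  obtain ⟨y', hy', hz₁⟩ := (mem_G _ _).1 hz
  rcases ((Order.lt_succ_iff_of_not_isMax hj).1 hy').lt_or_eq with h | h
  · exact (hz' ((mem_G _ _).2 ⟨y', h, hz₁⟩)).elim
  · obtain rfl := WithTop.coe_injective h
    exact hz₁

end StableComplex

/-! ### Every complex of projectives is a retract of a filtered one. -/

section Deconstruction

variable {B : Type u} [Category.{v} B] [Abelian B] [HasColimitsOfSize.{v, v} B] {P : B}

lemma complexesOfProjectives_le_retractClosure (hP : IsSeparator P)
    {κ : Cardinal.{v}} [Fact κ.IsRegular] [IsCardinalPresentable P κ] (hκ : HasCardinalLT ℤ κ) :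
    complexesOfProjectives B ≤ (filteredBy (smallComplexes κ P)).retractClosure := by
  intro X hX
  -- One index set serves all degrees: the generators of every `X.X m` are used in each degree `n`,
  -- and `q n` kills those with `m ≠ n`.
  let Y : Type v := Σ n : ULift.{v} ℤ, (P ⟶ X.X n.down)
  let q (n : ℤ) : (copower Y P).obj Set.univ ⟶ X.X n :=
    copowerDesc (fun y _ => if h : y.1.down = n then y.2 ≫ eqToHom (by rw [h]) else 0)
  have hq (n : ℤ) : Epi (q n) := by
    rw [Preadditive.epi_iff_cancel_zero]
    intro Z φ hφ
    refine (Preadditive.isSeparator_iff P).1 hP φ (fun g => ?_)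
    have := copowerι P (⟨⟨n⟩, g⟩ : Y) (Set.mem_univ _) ≫= hφ
    simpa [q, copowerι_desc_assoc] using this
  have (n : ℤ) : ∃ i : X.X n ⟶ (copower Y P).obj Set.univ, i ≫ q n = 𝟙 _ := by
    have : Projective (X.X n) := hX n
    exact ⟨Projective.factorThru (𝟙 _) (q n), Projective.factorThru_comp _ _⟩
  choose i hi using this
  -- Since `i n ≫ q n = 𝟙`, this differential squares to zero and makes both `i` and `q` chain maps.
  let d (n : ℤ) : (copower Y P).obj Set.univ ⟶ (copower Y P).obj Set.univ :=
    q n ≫ X.d n (n + 1) ≫ i (n + 1)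
  have hd (n : ℤ) : d n ≫ d (n + 1) = 0 := by
    simp [d, reassoc_of% hi]
  have hid (n : ℤ) : i n ≫ d n = X.d n (n + 1) ≫ i (n + 1) := by
    simp [d, reassoc_of% hi]
  have hqd (n : ℤ) : q n ≫ X.d n (n + 1) = d n ≫ q (n + 1) := by
    simp [d, hi]
  let U : { U : Set Y // IsStable d U } := ⟨Set.univ, isStable_univ⟩
  have hU (n : ℤ) : ((stableComplex hd).obj U).d n (n + 1) = d n := by
    have := CochainComplex.of_d (fun _ => (copower Y P).obj U.1) (stableDiff U.2) n
    rw [stableDiff_univ] at this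
    exact this
  refine ⟨_, filteredBy_stableComplex hd hκ, ⟨{
    i := { f := i, comm' := ?_ }
    r := { f := q, comm' := ?_ }
    retract := by ext n; exact hi n }⟩⟩
  · rintro n _ rfl
    change i n ≫ ((stableComplex hd).obj U).d n (n + 1) = _
    rw [hU]
    exact hid n
  · rintro n _ rfl
    change q n ≫ _ = ((stableComplex hd).obj U).d n (n + 1) ≫ q (n + 1)
    rw [hU]
    exact hqd n

variable [EnoughProjectives B] [Projective P] (hP : IsSeparator P) {κ : Cardinal.{v}}
  [Fact κ.IsRegular] [IsCardinalPresentable P κ] (hκ : HasCardinalLT ℤ κ)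

include hP hκ

lemma rightExtOrthogonal_smallComplexes :
    rightExtOrthogonal (smallComplexes κ P) = contraacyclicComplexes B := by
  rw [contraacyclicComplexes_eq]
  ext N
  refine ⟨fun hN X hX => ?_, fun hN T hT => hN T (smallComplexes_le _ hT)⟩
  obtain ⟨F, hF, ⟨r⟩⟩ := complexesOfProjectives_le_retractClosure hP hκ X hX
  exact (extVanishes_of_filteredBy hN hF).of_retract r

lemma complexesOfProjectives_eq_retractClosure :
    complexesOfProjectives B = (filteredBy (smallComplexes κ P)).retractClosure := by
  refine le_antisymm (complexesOfProjectives_le_retractClosure hP hκ) ?_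
  rintro X ⟨F, hF, ⟨r⟩⟩
  refine complexesOfProjectives_of_retract r ?_
  rw [complexesOfProjectives_eq]
  intro N hN
  refine extVanishes_of_filteredBy ?_ hF
  rwa [rightExtOrthogonal_smallComplexes hP hκ]

end Deconstruction

/-! ### Weak equivalences, trivial fibrations and trivial cofibrations. -/

section WeakEquivalences

open CochainComplex CochainComplex.HomComplex CochainComplex.mappingCone

variable {B : Type u} [Category.{v} B] [Abelian B]

variable (B) in
/-- The morphisms of complexes which induce bijections on the sets of morphisms in the homotopy
category from complexes of projective objects. -/
def contraderivedEquivalences : MorphismProperty (CochainComplex B ℤ) := fun X _ f =>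
  ∀ P : CochainComplex B ℤ, complexesOfProjectives B P →
    Function.Bijective
      (fun a : (HomotopyCategory.quotient B (ComplexShape.up ℤ)).obj P ⟶
          (HomotopyCategory.quotient B (ComplexShape.up ℤ)).obj X =>
        a ≫ (HomotopyCategory.quotient B (ComplexShape.up ℤ)).map f)

instance : (contraderivedEquivalences B).HasTwoOutOfThreeProperty where
  comp_mem f g hf hg P hP := by
    simpa [Function.comp_def] using (hg P hP).comp (hf P hP)
  of_postcomp f g hg hfg P hP := by
    refine (Function.Bijective.of_comp_iff' (hg P hP) _).1 ?_
    simpa [Function.comp_def] using hfg P hP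
  of_precomp f g hf hfg P hP := by
    refine (Function.Bijective.of_comp_iff _ (hf P hP)).1 ?_
    simpa [Function.comp_def] using hfg P hP

lemma contraderivedEquivalences_iff {X Y : CochainComplex B ℤ} (f : X ⟶ Y) :
    contraderivedEquivalences B f ↔ ∀ P : CochainComplex B ℤ, complexesOfProjectives B P →
      (∀ (a : P ⟶ X) (b : coneId P ⟶ Y), a ≫ f = coneIdInr P ≫ b →
        ∃ h : coneId P ⟶ X, coneIdInr P ≫ h = a) ∧
      (∀ b : P ⟶ Y, ∃ (a : P ⟶ X) (h : coneId P ⟶ Y), b = a ≫ f + coneIdInr P ≫ h) := by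
  let Q := HomotopyCategory.quotient B (ComplexShape.up ℤ)
  refine forall₂_congr (fun P hP => and_congr ?_ ?_)
  · change Function.Injective (Preadditive.rightComp (Q.obj P) (Q.map f)) ↔ _
    rw [injective_iff_map_eq_zero]
    constructor
    · intro h a b hab
      rw [← quotient_map_eq_zero_iff_exists_extension]
      refine h (Q.map a) ?_
      change Q.map a ≫ Q.map f = 0
      rw [← Q.map_comp, quotient_map_eq_zero_iff_exists_extension]
      exact ⟨b, hab.symm⟩
    · intro h a ha
      obtain ⟨a, rfl⟩ := Q.map_surjective a
      change Q.map a ≫ Q.map f = 0 at ha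
      rw [← Q.map_comp, quotient_map_eq_zero_iff_exists_extension] at ha
      obtain ⟨b, hb⟩ := ha
      rw [quotient_map_eq_zero_iff_exists_extension]
      exact h a b hb.symm
  · have key (b : P ⟶ Y) (a : P ⟶ X) : Q.map a ≫ Q.map f = Q.map b ↔
        ∃ h : coneId P ⟶ Y, b = a ≫ f + coneIdInr P ≫ h := by
      rw [← Q.map_comp, eq_comm, ← sub_eq_zero, ← Q.map_sub,
        quotient_map_eq_zero_iff_exists_extension]
      exact exists_congr (fun h => by rw [eq_comm, sub_eq_iff_eq_add'])
    constructor
    · intro h b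
      obtain ⟨a, ha⟩ := h (Q.map b)
      obtain ⟨a, rfl⟩ := Q.map_surjective a
      exact ⟨a, (key b a).1 ha⟩
    · intro h b
      obtain ⟨b, rfl⟩ := Q.map_surjective b
      obtain ⟨a, ha⟩ := h b
      exact ⟨Q.map a, (key b a).2 ha⟩

lemma contraderivedEquivalences_initial_to_iff (X : CochainComplex B ℤ) :
    contraderivedEquivalences B (initial.to X) ↔ contraacyclicComplexes B X := by
  have hi : IsZero (⊥_ (CochainComplex B ℤ)) := IsInitial.isZero initialIsInitial
  rw [contraderivedEquivalences_iff, contraacyclicComplexes_iff]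
  refine forall₂_congr (fun P hP => ⟨fun h b => ?_, fun h => ⟨fun a b hab => ?_, fun b => ?_⟩⟩)
  · obtain ⟨a, h, hb⟩ := h.2 b
    rw [hi.eq_of_tgt a 0, zero_comp, zero_add] at hb
    exact ⟨h, hb.symm⟩
  · exact ⟨0, hi.eq_of_tgt _ _⟩
  · obtain ⟨h, rfl⟩ := h b
    exact ⟨0, h, by simp⟩

lemma exists_lift_of_episWithKernelIn [EnoughProjectives B] {X Y P : CochainComplex B ℤ}
    {f : X ⟶ Y} (hf : episWithKernelIn (contraacyclicComplexes B) f)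
    (hP : complexesOfProjectives B P) (b : P ⟶ Y) : ∃ a : P ⟶ X, a ≫ f = b := by
  have := hasLiftingProperty_of_projective_cokernel (initial.to P) f
    ((monosWithCokernelIn_initial_to_iff _ P).2 hP) hf
  have sq : CommSq (initial.to X) (initial.to P) f b := ⟨Subsingleton.elim _ _⟩
  exact ⟨sq.lift, sq.fac_right⟩

lemma contraderivedEquivalences_of_episWithKernelIn [EnoughProjectives B]
    {X Y : CochainComplex B ℤ} {f : X ⟶ Y}
    (hf : episWithKernelIn (contraacyclicComplexes B) f) : contraderivedEquivalences B f := by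
  rw [contraderivedEquivalences_iff]
  refine fun P hP => ⟨fun a b hab => ?_, fun b => ?_⟩
  · have := hasLiftingProperty_of_projective_cokernel _ f (monosWithCokernelIn_coneIdInr hP) hf
    have sq : CommSq a (coneIdInr P) f b := ⟨hab⟩
    exact ⟨sq.lift, sq.fac_left⟩
  · obtain ⟨a, rfl⟩ := exists_lift_of_episWithKernelIn hf hP b
    exact ⟨a, 0, by simp⟩

lemma exists_coneId_proj (P : CochainComplex B ℤ) :
    ∃ (π : coneId P ⟶ P⟦(1 : ℤ)⟧) (_ : Epi π), coneIdInr P ≫ π = 0 ∧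
      ∀ ⦃Y : CochainComplex B ℤ⦄ (φ : coneId P ⟶ Y), coneIdInr P ≫ φ = 0 → ∃ c, π ≫ c = φ := by
  have hS := shortExact_triangleRotateShortComplex P
  have := hS.epi_g
  exact ⟨_, hS.epi_g, (triangleRotateShortComplex (𝟙 P)).zero,
    fun Y φ hφ => ⟨hS.exact.desc φ hφ, hS.exact.g_desc φ hφ⟩⟩

/-- Injectivity on homotopy classes extends `a` to the cone. The error against `b` factors through
`P⟦1⟧`; surjectivity there lifts it up to a null-homotopy, which itself lifts along `f` because the
cone is projective. -/
lemma episWithKernelIn_of_contraderivedEquivalences {X Y : CochainComplex B ℤ} {f : X ⟶ Y}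
    [Epi f] (hf : contraderivedEquivalences B f) :
    episWithKernelIn (contraacyclicComplexes B) f := by
  rw [contraderivedEquivalences_iff] at hf
  refine episWithKernelIn_contraacyclic_of_hasLiftingProperty f (fun P hP => ⟨fun {a b} sq => ?_⟩)
  obtain ⟨h, rfl⟩ := (hf P hP).1 a b sq.w
  obtain ⟨π, _, hπ, hπ'⟩ := exists_coneId_proj P
  obtain ⟨c, hc⟩ := hπ' (h ≫ f - b) (by
    rw [Preadditive.comp_sub, ← sq.w, Category.assoc, sub_self])
  obtain ⟨c', k, hk⟩ := (hf _ (complexesOfProjectives_shift hP 1)).2 c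
  have := projective_coneId (complexesOfProjectives_shift hP 1)
  let k' := Projective.factorThru k f
  have hk' : k' ≫ f = k := Projective.factorThru_comp _ _
  refine ⟨⟨⟨h - π ≫ (c' + coneIdInr _ ≫ k'), ?_, ?_⟩⟩⟩
  · rw [Preadditive.comp_sub, reassoc_of% hπ, zero_comp, sub_zero]
  · rw [Preadditive.sub_comp, Category.assoc, Preadditive.add_comp, Category.assoc, hk', ← hk, hc]
    abel

lemma epimorphisms_inf_contraderivedEquivalences [EnoughProjectives B] :
    MorphismProperty.epimorphisms (CochainComplex B ℤ) ⊓ contraderivedEquivalences B =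
      episWithKernelIn (contraacyclicComplexes B) := by
  apply le_antisymm
  · rintro X Y f ⟨hf, hf'⟩
    have : Epi f := hf
    exact episWithKernelIn_of_contraderivedEquivalences hf'
  · exact fun X Y f hf => ⟨hf.1, contraderivedEquivalences_of_episWithKernelIn hf⟩

lemma exists_extension_coneId (Z : CochainComplex B ℤ) {P : CochainComplex B ℤ}
    (a : P ⟶ coneId Z) : ∃ h : coneId P ⟶ coneId Z, coneIdInr P ≫ h = a := by
  obtain ⟨h, hh⟩ := exists_coneId_lift (X := coneId P) (Z := Z)
    (Cochain.ofHoms (fun n => (snd (𝟙 P)).v n n (add_zero n) ≫ a.f n ≫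
      (snd (𝟙 Z)).v n n (add_zero n)))
  refine ⟨h, hom_coneId_ext (fun n => ?_)⟩
  rw [HomologicalComplex.comp_f, Category.assoc, hh]
  simp

/-- A projective complex is a retract of the cone on its shift by -1, hence contractible. -/
lemma exists_extension_of_projective (C : CochainComplex B ℤ) [Projective C]
    {P : CochainComplex B ℤ} (a : P ⟶ C) : ∃ h : coneId P ⟶ C, coneIdInr P ≫ h = a := by
  obtain ⟨π', _, -⟩ := exists_coneId_proj (C⟦(-1 : ℤ)⟧)
  let e : C⟦(-1 : ℤ)⟧⟦(1 : ℤ)⟧ ≅ C := shiftNegShift C (1 : ℤ)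
  let π : coneId (C⟦(-1 : ℤ)⟧) ⟶ C := π' ≫ e.hom
  obtain ⟨h, hh⟩ := exists_extension_coneId _ (a ≫ Projective.factorThru (𝟙 C) π)
  exact ⟨h ≫ π, by rw [reassoc_of% hh, Projective.factorThru_comp, Category.comp_id]⟩

/-- Such a map is a split monomorphism whose complement is projective, hence contractible. -/
lemma contraderivedEquivalences_of_llp_epimorphisms {X Y : CochainComplex B ℤ} {f : X ⟶ Y}
    (hf : (MorphismProperty.epimorphisms (CochainComplex B ℤ)).llp f) :
    contraderivedEquivalences B f := by
  obtain ⟨r, hr⟩ : ∃ r : Y ⟶ X, f ≫ r = 𝟙 X := by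
    have : HasLiftingProperty f (0 : X ⟶ 0) := hf _ (show Epi _ from inferInstance)
    have sq : CommSq (𝟙 X) f (0 : X ⟶ 0) 0 := ⟨by simp⟩
    exact ⟨sq.lift, sq.fac_left⟩
  obtain ⟨_, _⟩ := (epimorphisms_llp_iff f).1 hf
  rw [contraderivedEquivalences_iff]
  refine fun P _ => ⟨fun a b hab => ⟨b ≫ r, ?_⟩, fun b => ?_⟩
  · rw [← Category.assoc, ← hab, Category.assoc, hr, Category.comp_id]
  · have h0 : f ≫ (𝟙 Y - r ≫ f) = 0 := by
      rw [Preadditive.comp_sub, reassoc_of% hr, Category.comp_id, sub_self]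
    obtain ⟨h, hh⟩ := exists_extension_of_projective _ (b ≫ cokernel.π f)
    refine ⟨b ≫ r, h ≫ cokernel.desc f _ h0, ?_⟩
    rw [reassoc_of% hh, cokernel.π_desc]
    simp

lemma exists_factorization_llp_epimorphisms {E : Type u} [Category.{v} E] [Abelian E]
    [EnoughProjectives E] {X Y : E} (f : X ⟶ Y) :
    ∃ (Z : E) (i : X ⟶ Z) (p : Z ⟶ Y), i ≫ p = f ∧ (MorphismProperty.epimorphisms E).llp i ∧
      Epi p := by
  refine ⟨X ⊞ Projective.over Y, biprod.inl, biprod.desc f (Projective.π Y), by simp, ?_, ?_⟩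
  · intro X' Y' p (_ : Epi p)
    exact ⟨fun {a b} sq => ⟨⟨biprod.desc a (Projective.factorThru (biprod.inr ≫ b) p), by simp,
      biprod.hom_ext' _ _ (by simpa using sq.w) (by simp)⟩⟩⟩
  · exact epi_of_epi_fac (biprod.inr_desc f (Projective.π Y))

lemma monosWithCokernelIn_inf_contraderivedEquivalences [EnoughProjectives B] :
    monosWithCokernelIn (complexesOfProjectives B) ⊓ contraderivedEquivalences B =
      (MorphismProperty.epimorphisms (CochainComplex B ℤ)).llp := by
  apply le_antisymm
  · rintro X Y f ⟨hf, hf'⟩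
    -- Retract argument: by two-out-of-three `p` is a weak equivalence, so `f` lifts against it and
    -- is a retract of `i`.
    obtain ⟨Z, i, p, fac, hi, hp⟩ := exists_factorization_llp_epimorphisms f
    have hp' : contraderivedEquivalences B p :=
      MorphismProperty.of_precomp (contraderivedEquivalences B) i p
        (contraderivedEquivalences_of_llp_epimorphisms hi) (by rwa [fac])
    have := hasLiftingProperty_of_projective_cokernel f p hf
      (episWithKernelIn_of_contraderivedEquivalences hp')
    exact MorphismProperty.of_retract (RetractArrow.ofLeftLiftingProperty fac) hi
  · refine fun X Y f hf => ⟨?_, contraderivedEquivalences_of_llp_epimorphisms hf⟩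
    rw [← llp_episWithKernelIn_contraacyclicComplexes]
    exact fun _ _ p hp => hf p hp.1

end WeakEquivalences

/-! ### Heredity and completeness of the cotorsion pair. -/

section Hereditary

variable {B : Type u} [Category.{v} B] [Abelian B]

lemma containsKernelsOfEpis_complexesOfProjectives :
    ContainsKernelsOfEpis (complexesOfProjectives B) := by
  intro S hS h₂ h₃ n
  have hS' := hS.map_of_exact (HomologicalComplex.eval B (ComplexShape.up ℤ) n)
  have := h₂ n
  have : Projective (S.map (HomologicalComplex.eval B (ComplexShape.up ℤ) n)).X₃ := h₃ n
  let s := hS'.splittingOfProjective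
  let r : Retract (S.X₁.X n) (S.X₂.X n) := { i := S.f.f n, r := s.r, retract := s.f_r }
  exact ⟨fun {M N} f e _ => ⟨r.i ≫ Projective.factorThru (r.r ≫ f) e, by simp⟩⟩

variable [EnoughProjectives B]

lemma episWithKernelIn_of_shortExact {E : Type u} [Category.{v} E] [Abelian E]
    {W : ObjectProperty E} {S : ShortComplex E} (hS : S.ShortExact) :
    episWithKernelIn W S.g ↔ W.isoClosure S.X₁ := by
  have := hS.epi_g
  have := hS.mono_f
  refine (and_iff_right hS.epi_g).trans (W.isoClosure.prop_iff_of_iso ?_)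
  exact (kernelIsKernel S.g).conePointUniqueUpToIso hS.fIsKernel

lemma containsCokernelsOfMonos_contraacyclicComplexes :
    ContainsCokernelsOfMonos (contraacyclicComplexes B) := by
  intro S hS h₁ h₂
  rw [contraacyclicComplexes_iff] at h₂ ⊢
  intro P hP b
  obtain ⟨a, rfl⟩ := exists_lift_of_episWithKernelIn
    ((episWithKernelIn_of_shortExact hS).2 (ObjectProperty.le_isoClosure _ _ h₁)) hP b
  obtain ⟨h, rfl⟩ := h₂ P hP a
  exact ⟨h ≫ S.g, by simp⟩

-- By two-out-of-three `S.g` is a weak equivalence, and an epimorphic one has contraacyclic kernel.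
omit [EnoughProjectives B] in
lemma containsKernelsOfEpis_contraacyclicComplexes :
    ContainsKernelsOfEpis (contraacyclicComplexes B) := by
  intro S hS h₂ h₃
  have := hS.epi_g
  rw [← contraderivedEquivalences_initial_to_iff] at h₂ h₃
  rw [← ObjectProperty.isoClosure_eq_self (contraacyclicComplexes B),
    ← episWithKernelIn_of_shortExact hS]
  refine episWithKernelIn_of_contraderivedEquivalences ?_
  refine MorphismProperty.of_precomp (contraderivedEquivalences B) (initial.to S.X₂) S.g
    h₂ ?_
  rwa [Subsingleton.elim (initial.to S.X₂ ≫ S.g) (initial.to S.X₃)]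

lemma complexesOfProjectives_of_projective (C : CochainComplex B ℤ) [Projective C] :
    complexesOfProjectives B C := by
  rw [← monosWithCokernelIn_initial_to_iff (complexesOfProjectives B)]
  have h : (MorphismProperty.epimorphisms (CochainComplex B ℤ)).llp (initial.to C) :=
    (epimorphisms_llp_initial_to_iff C).2 inferInstance
  rw [← monosWithCokernelIn_inf_contraderivedEquivalences] at h
  exact h.1

/-- Dimension shifting: the syzygies of `A` are again complexes of projectives. -/
lemma extVanishes_of_contraacyclic {A X : CochainComplex B ℤ} (hA : complexesOfProjectives B A)
    (hX : contraacyclicComplexes B X) (n : ℕ) : ExtVanishes (n + 1) A X := by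
  induction n generalizing A with
  | zero =>
    rw [contraacyclicComplexes_eq] at hX
    exact hX A hA
  | succ n hn =>
    have hS := shortExact_kernel (Projective.π A)
    have : Projective (ShortComplex.mk _ _ (kernel.condition (Projective.π A))).X₂ :=
      Projective.projective_over A
    exact ExtVanishes.succ hS (hn (containsKernelsOfEpis_complexesOfProjectives _ hS
      (complexesOfProjectives_of_projective _) hA))

variable (B) in
lemma isHereditaryCotorsionPair :
    IsHereditaryCotorsionPair (complexesOfProjectives B) (contraacyclicComplexes B) where
  left_closed := containsKernelsOfEpis_complexesOfProjectives
  right_closed := containsCokernelsOfMonos_contraacyclicComplexes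
  ext_vanishes n hn A X hA hX := by
    obtain ⟨n, rfl⟩ := Nat.exists_eq_add_of_le' hn
    exact extVanishes_of_contraacyclic hA hX n

lemma isCompleteCotorsionPair [MorphismProperty.HasFactorization
      (monosWithCokernelIn (complexesOfProjectives B))
      (episWithKernelIn (contraacyclicComplexes B))] :
    IsCompleteCotorsionPair (complexesOfProjectives B) (contraacyclicComplexes B) where
  right_eq := contraacyclicComplexes_eq
  left_eq := complexesOfProjectives_eq
  exists_precover X := by
    have h := MorphismProperty.factorizationData
      (monosWithCokernelIn (complexesOfProjectives B))
      (episWithKernelIn (contraacyclicComplexes B)) (initial.to X)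
    obtain ⟨_, hp⟩ := h.hp
    rw [ObjectProperty.isoClosure_eq_self] at hp
    refine ⟨_, _, _, _, _, shortExact_kernel h.p, hp, ?_⟩
    rw [← monosWithCokernelIn_initial_to_iff (complexesOfProjectives B),
      Subsingleton.elim (initial.to _) h.i]
    exact h.hi
  exists_preenvelope X := by
    -- Factoring `X ⟶ 0` gives the preenvelope: the middle object is the kernel of its map to zero,
    -- hence contraacyclic.
    have h := MorphismProperty.factorizationData
      (monosWithCokernelIn (complexesOfProjectives B))
      (episWithKernelIn (contraacyclicComplexes B)) (0 : X ⟶ 0)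
    obtain ⟨_, hi⟩ := h.hi
    obtain ⟨_, hp⟩ := h.hp
    rw [ObjectProperty.isoClosure_eq_self] at hi hp
    have h0 : h.p = 0 := (isZero_zero _).eq_of_tgt _ _
    exact ⟨_, _, _, _, _, shortExact_cokernel h.i, (contraacyclicComplexes B).prop_of_iso
      (kernelIsoOfEq h0 ≪≫ kernelZeroIsoSource) hp, hi⟩

end Hereditary

/-! ### The contraderived model structure. -/

section Model

open MorphismProperty

variable (B : Type u) [Category.{v} B] [Abelian B] [EnoughProjectives B]

instance isWeakFactorizationSystem_epimorphisms {E : Type u} [Category.{v} E] [Abelian E]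
    [EnoughProjectives E] : IsWeakFactorizationSystem (epimorphisms E).llp (epimorphisms E) :=
  have : HasFactorization (epimorphisms E).llp (epimorphisms E) := ⟨fun f => by
    obtain ⟨Z, i, p, fac, hi, hp⟩ := exists_factorization_llp_epimorphisms f
    exact ⟨{ Z := Z, i := i, p := p, fac := fac, hi := hi, hp := hp }⟩⟩
  IsWeakFactorizationSystem.mk' _ _ (fun _ _ hi hp => hi _ hp)

lemma isWeakFactorizationSystem_of_rlp_eq {I : MorphismProperty (CochainComplex B ℤ)}
    [HasSmallObjectArgument.{v} I] (hI : I.rlp = episWithKernelIn (contraacyclicComplexes B)) :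
    IsWeakFactorizationSystem (monosWithCokernelIn (complexesOfProjectives B))
      (episWithKernelIn (contraacyclicComplexes B)) := by
  rw [← llp_episWithKernelIn_contraacyclicComplexes, ← hI]
  exact { rlp := rlp_llp_rlp I, llp := rfl }

/-- The contraderived model structure. -/
@[reducible]
noncomputable def contraderivedModelCategory
    [h : IsWeakFactorizationSystem (monosWithCokernelIn (complexesOfProjectives B))
      (episWithKernelIn (contraacyclicComplexes B))] :
    ModelCategory (CochainComplex B ℤ) :=
  letI : CategoryWithFibrations (CochainComplex B ℤ) := ⟨epimorphisms _⟩
  letI : CategoryWithCofibrations (CochainComplex B ℤ) :=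
    ⟨monosWithCokernelIn (complexesOfProjectives B)⟩
  letI : CategoryWithWeakEquivalences (CochainComplex B ℤ) := ⟨contraderivedEquivalences B⟩
  haveI : (weakEquivalences (CochainComplex B ℤ)).HasTwoOutOfThreeProperty :=
    inferInstanceAs (contraderivedEquivalences B).HasTwoOutOfThreeProperty
  haveI : IsWeakFactorizationSystem (cofibrations (CochainComplex B ℤ))
      (trivialFibrations (CochainComplex B ℤ)) := by
    rwa [show trivialFibrations (CochainComplex B ℤ) = _ from
      epimorphisms_inf_contraderivedEquivalences]
  haveI : IsWeakFactorizationSystem (trivialCofibrations (CochainComplex B ℤ))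
      (fibrations (CochainComplex B ℤ)) := by
    rw [show trivialCofibrations (CochainComplex B ℤ) = _ from
      monosWithCokernelIn_inf_contraderivedEquivalences]
    exact isWeakFactorizationSystem_epimorphisms
  ModelCategory.mk' _

section

variable [IsWeakFactorizationSystem (monosWithCokernelIn (complexesOfProjectives B))
      (episWithKernelIn (contraacyclicComplexes B))]

attribute [local instance] contraderivedModelCategory

lemma cofibrantObjects_eq :
    cofibrantObjects (CochainComplex B ℤ) = complexesOfProjectives B := by
  ext X
  change IsCofibrant X ↔ _
  rw [isCofibrant_iff, cofibration_iff]
  exact monosWithCokernelIn_initial_to_iff _ X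

lemma fibrantObjects_eq_top : fibrantObjects (CochainComplex B ℤ) = ⊤ := by
  ext X
  change IsFibrant X ↔ _
  rw [isFibrant_iff, fibration_iff]
  have : Epi (terminal.from X) := (IsTerminal.isZero terminalIsTerminal).epi _
  exact iff_of_true this trivial

lemma weaklyTrivialObjects_eq :
    weaklyTrivialObjects (CochainComplex B ℤ) = contraacyclicComplexes B := by
  ext X
  change WeakEquivalence _ ↔ _
  rw [weakEquivalence_iff]
  exact contraderivedEquivalences_initial_to_iff X

lemma isAbelianModel : IsAbelianModel (CochainComplex B ℤ) where
  cofibrations_eq := by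
    rw [cofibrantObjects_eq]
    rfl
  fibrations_eq := by
    rw [fibrantObjects_eq_top]
    ext X Y f
    exact (and_iff_left (ObjectProperty.le_isoClosure _ _ trivial)).symm

lemma isHereditaryModel : IsHereditaryModel (CochainComplex B ℤ) where
  cofibrant := by
    rw [cofibrantObjects_eq]
    exact containsKernelsOfEpis_complexesOfProjectives
  trivially_cofibrant := by
    rw [cofibrantObjects_eq, weaklyTrivialObjects_eq]
    exact fun S hS h₂ h₃ => ⟨containsKernelsOfEpis_complexesOfProjectives S hS h₂.1 h₃.1,
      containsKernelsOfEpis_contraacyclicComplexes S hS h₂.2 h₃.2⟩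
  fibrant := by
    rw [fibrantObjects_eq_top]
    exact fun _ _ _ _ => trivial
  trivially_fibrant := by
    rw [fibrantObjects_eq_top, weaklyTrivialObjects_eq, top_inf_eq]
    exact containsCokernelsOfMonos_contraacyclicComplexes

lemma isCofibrantlyGeneratedModel [HasColimitsOfSize.{v, v} B] {P : B} [Projective P]
    (hP : IsSeparator P) {I : MorphismProperty (CochainComplex B ℤ)} [IsSmall.{v} I]
    (hI : I.rlp = episWithKernelIn (contraacyclicComplexes B)) :
    IsCofibrantlyGeneratedModel (CochainComplex B ℤ) where
  trivialFibrations := ⟨I, inferInstance, hI.trans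
    epimorphisms_inf_contraderivedEquivalences.symm⟩
  fibrations := by
    -- One generator suffices for the fibrations: it detects epimorphisms by the separator property,
    -- and lifts against all of them because the cone is projective.
    refine ⟨ofHoms (fun _ : PUnit.{v + 1} => initial.to (coneId (zeroDiff (fun _ => P)))),
      inferInstance, le_antisymm (fun X Y p hp => ?_) ?_⟩
    · exact epi_of_hasLiftingProperty hP p (hp _ (ofHoms.mk ⟨⟩))
    · change epimorphisms _ ≤ _
      rw [← le_llp_iff_le_rlp]
      rintro _ _ _ ⟨_⟩
      exact (epimorphisms_llp_initial_to_iff _).2 (projective_coneId (fun _ => ‹Projective P›))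

end

end Model

lemma exists_regular_cardinal_isCardinalPresentable {C : Type u} [Category.{v} C] (X : C)
    [IsPresentable.{v} X] :
    ∃ (κ : Cardinal.{v}) (_ : Fact κ.IsRegular), IsCardinalPresentable X κ ∧ HasCardinalLT ℤ κ := by
  obtain ⟨κ₀, _, h⟩ := Functor.IsAccessible.exists_cardinal.{v} (F := coyoneda.obj (Opposite.op X))
  have : IsCardinalPresentable X κ₀ := h
  -- `κ` must exceed both ℤ, for presentability of complexes, and `κ₀`, for presentability of `X`.
  obtain ⟨κ, hκ, hκ'⟩ := HasCardinalLT.exists_regular_cardinal_forall.{v}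
    (Sum.elim (fun _ : Unit => ULift.{v} ℤ) (fun _ : Unit => κ₀.ord.ToType))
  have : Fact κ.IsRegular := ⟨hκ⟩
  refine ⟨κ, inferInstance, isCardinalPresentable_of_le X (κ := κ₀) ?_, ?_⟩
  · simpa using ((hasCardinalLT_iff_cardinal_mk_lt _ _).1 (hκ' (Sum.inr ()))).le
  · exact (hasCardinalLT_iff_of_equiv Equiv.ulift κ).1 (hκ' (Sum.inl ()))

end Contraderived

theorem mainTheorem5 {B : Type u} [Category.{v} B] [Abelian B]
    [IsLocallyPresentable.{v} B] [EnoughProjectives B] :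
    (IsCompleteCotorsionPair (complexesOfProjectives B) (contraacyclicComplexes B) ∧
      IsHereditaryCotorsionPair (complexesOfProjectives B) (contraacyclicComplexes B)) ∧
    (∃ S : ObjectProperty (CochainComplex B ℤ),
      ObjectProperty.Small.{v} S ∧ S ≤ complexesOfProjectives B ∧
      complexesOfProjectives B = (filteredBy S).retractClosure ∧
      IsGeneratedBy S (complexesOfProjectives B) (contraacyclicComplexes B)) ∧
    (∃ _ : ModelCategory (CochainComplex B ℤ),
      IsAbelianModel (CochainComplex B ℤ) ∧
      cofibrantObjects (CochainComplex B ℤ) = complexesOfProjectives B ∧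
      weaklyTrivialObjects (CochainComplex B ℤ) = contraacyclicComplexes B ∧
      fibrantObjects (CochainComplex B ℤ) = ⊤ ∧
      IsCofibrantlyGeneratedModel (CochainComplex B ℤ) ∧
      IsHereditaryModel (CochainComplex B ℤ)) := by
  obtain ⟨κ₀, _, _⟩ := IsLocallyPresentable.exists_cardinal.{v} B
  have : HasColimitsOfSize.{v, v} B := inferInstance
  obtain ⟨P, _, hP⟩ := exists_projective_separator (B := B)
  obtain ⟨κ, _, _, hκ⟩ := exists_regular_cardinal_isCardinalPresentable P
  have hW := rightExtOrthogonal_smallComplexes hP hκ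
  have hI := rlp_generatingCofibrations hP hW
  have := hasSmallObjectArgument_generatingCofibrations (P := P) hκ
  have := isWeakFactorizationSystem_of_rlp_eq B hI
  exact ⟨⟨isCompleteCotorsionPair, isHereditaryCotorsionPair B⟩,
    ⟨smallComplexes κ P, inferInstance, smallComplexes_le,
      complexesOfProjectives_eq_retractClosure hP hκ, hW.symm, complexesOfProjectives_eq⟩,
    ⟨contraderivedModelCategory B, isAbelianModel B, cofibrantObjects_eq B,
      weaklyTrivialObjects_eq B, fibrantObjects_eq_top B,
      isCofibrantlyGeneratedModel B hP hI, isHereditaryModel B⟩⟩
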